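/- A preference over a finite set $A$ of $m\ge 1$ alternatives is a linear order on $A$, and $\mathrm{pos}(a,\succ)\in\{1,\dots,m\}$ denotes the position of $a$ in $\succ$, counted from the top. For preferences $\succ,\succ'$ over $A$ consider - the swap distance: the number of unordered pairs of alternatives that $\succ$ and $\succ'$ order differently; - the footrule distance: $\sum_{a\in A}|\mathrm{pos}(a,\succ)-\mathrm{pos}(a,\succ')|$; - the maximum displacement distance: $\max_{a\in A}|\mathrm{pos}(a,\succ)-\mathrm{pos}(a,\succ')|$. For an integer $k\ge 0$, the $k$-approval score of an alternative in a profile $(\succ_i)_{i\in[n]}$, $n\ge 1$, is the number of $i$ such that the alternative is among the first $k$ positions of $\succ_i$; the $k$-approval winners are the alternatives of maximum score. Plurality is $1$-approval and veto is $(m-1)$-approval. Let $r$ be a voting rule and $d$ a distance. An instance of $d$-Local Distance constrained \$bribery for $r$ consists of a set $A$ of $m$ alternatives, a profile $(\succ_i)_{i\in[n]}$ of $n\ge1$ preferences over $A$, non-negative integers $\delta_i$ (distance bounds) and $p_i$ (prices) for $i\in[n]$, a non-negative integer budget $B$, and an alternative $c\in A$. The question is whether there are a set $J\subseteq[n]$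 and preferences $(\succ_i')_{i\in J}$ over $A$ such that $\sum_{i\in J}p_i\le B$, $d(\succ_i,\succ_i')\le\delta_i$ for every $i\in J$, and $c$ is the only winner under $r$ of the profile obtained from $(\succ_i)_{i\in[n]}$ by replacing $\succ_i$ with $\succ_i'$ for every $i\in J$. **Theorem.** For $r$ either of plurality and veto, and for $d$ any of the swap, footrule and maximum displacement distances, $d$-Local Distance constrained \$bribery for $r$ is solvable in deterministic polynomial time, i.e. by one algorithm (a program of a random access machine with logarithmic cost) whose running time is bounded by a polynomial in the length of the instance, where each preference is given as a list of the alternatives and all numbers $\delta_i,p_i,B$ are written in binary. -/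

import Mathlib

/-! ## Random access machines with logarithmic cost

The memory consists of arrays `A_0, A_1, A_2, …` of natural numbers, all cells being initially zero
apart from the input. Programs are while-programs over this memory with indirect addressing and the
arithmetic instructions `+`, `-` (truncated), `*`, `/` (floor). Running times are measured with the
logarithmic cost criterion: handling a number costs its binary length, addresses included. -/

namespace RAM

/-- A memory configuration: `s a i` is the content of the cell `A_a[i]`. -/
abbrev Memory := ℕ → ℕ → ℕ

/-- Arithmetic expressions. `get a e` reads the cell of the (fixed) array `A_a` whose address is the
value of `e`. -/
inductive Expr where
  | lit (v : ℕ)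
  | get (a : ℕ) (e : Expr)
  | add (e f : Expr)
  | sub (e f : Expr)
  | mul (e f : Expr)
  | div (e f : Expr)

/-- The value of an expression. -/
def Expr.eval (s : Memory) : Expr → ℕ
  | .lit v => v
  | .get a e => s a (e.eval s)
  | .add e f => e.eval s + f.eval s
  | .sub e f => e.eval s - f.eval s
  | .mul e f => e.eval s * f.eval s
  | .div e f => e.eval s / f.eval s

/-- The logarithmic cost of evaluating an expression: every subexpression costs one more than the
binary length of its value. -/
def Expr.cost (s : Memory) : Expr → ℕ
  | .lit v => v.size + 1
  | .get a e => e.cost s + (s a (e.eval s)).size + 1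
  | .add e f => e.cost s + f.cost s + (e.eval s + f.eval s).size + 1
  | .sub e f => e.cost s + f.cost s + (e.eval s - f.eval s).size + 1
  | .mul e f => e.cost s + f.cost s + (e.eval s * f.eval s).size + 1
  | .div e f => e.cost s + f.cost s + (e.eval s / f.eval s).size + 1

/-- Programs. `assign a i e` is the assignment `A_a[i] := e`; the tests of `cond` and `loop`
(if-then-else and while) check whether the value of an expression is nonzero. -/
inductive Program where
  | skip
  | assign (a : ℕ) (i e : Expr)
  | seq (p q : Program)
  | cond (e : Expr) (p q : Program)
  | loop (e : Expr) (p : Program)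

/-- The memory after writing `v` into the cell `A_a[i]`. -/
def Memory.write (s : Memory) (a i v : ℕ) : Memory :=
  fun b j => if b = a ∧ j = i then v else s b j

/-- `Exec p s t s'`: started in memory `s`, the program `p` halts in memory `s'`, and the
logarithmic cost of the run is exactly `t`. -/
inductive Exec : Program → Memory → ℕ → Memory → Prop where
  | skip (s : Memory) : Exec .skip s 1 s
  | assign (s : Memory) (a : ℕ) (i e : Expr) :
      Exec (.assign a i e) s (i.cost s + e.cost s + 1) (s.write a (i.eval s) (e.eval s))
  | seq {p q : Program} {s s' s'' : Memory} {t t' : ℕ} :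
      Exec p s t s' → Exec q s' t' s'' → Exec (.seq p q) s (t + t' + 1) s''
  | cond_true {e : Expr} {p q : Program} {s s' : Memory} {t : ℕ} :
      e.eval s ≠ 0 → Exec p s t s' → Exec (.cond e p q) s (e.cost s + t + 1) s'
  | cond_false {e : Expr} {p q : Program} {s s' : Memory} {t : ℕ} :
      e.eval s = 0 → Exec q s t s' → Exec (.cond e p q) s (e.cost s + t + 1) s'
  | loop_true {e : Expr} {p : Program} {s s' s'' : Memory} {t t' : ℕ} :
      e.eval s ≠ 0 → Exec p s t s' → Exec (.loop e p) s' t' s'' →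
        Exec (.loop e p) s (e.cost s + t + t' + 1) s''
  | loop_false {e : Expr} {p : Program} {s : Memory} :
      e.eval s = 0 → Exec (.loop e p) s (e.cost s + 1) s

/-- Programs are deterministic: the final memory and the running time are determined by the program
and the initial memory. -/
theorem Exec.deterministic {p : Program} {s s₁ : Memory} {t₁ : ℕ} (h₁ : Exec p s t₁ s₁) :
    ∀ {s₂ : Memory} {t₂ : ℕ}, Exec p s t₂ s₂ → t₁ = t₂ ∧ s₁ = s₂ := by
  induction h₁ with
  | skip s => intro s₂ t₂ h₂; cases h₂; exact ⟨rfl, rfl⟩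
  | assign s a i e => intro s₂ t₂ h₂; cases h₂; exact ⟨rfl, rfl⟩
  | seq _ _ ih ih' =>
    intro s₂ t₂ h₂
    cases h₂ with
    | seq g g' =>
      obtain ⟨rfl, rfl⟩ := ih g
      obtain ⟨rfl, rfl⟩ := ih' g'
      exact ⟨rfl, rfl⟩
  | cond_true he _ ih =>
    intro s₂ t₂ h₂
    cases h₂ with
    | cond_true _ g => obtain ⟨rfl, rfl⟩ := ih g; exact ⟨rfl, rfl⟩
    | cond_false he' _ => exact absurd he' he
  | cond_false he _ ih =>
    intro s₂ t₂ h₂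
    cases h₂ with
    | cond_true he' _ => exact absurd he he'
    | cond_false _ g => obtain ⟨rfl, rfl⟩ := ih g; exact ⟨rfl, rfl⟩
  | loop_true he _ _ ih ih' =>
    intro s₂ t₂ h₂
    cases h₂ with
    | loop_true _ g g' =>
      obtain ⟨rfl, rfl⟩ := ih g
      obtain ⟨rfl, rfl⟩ := ih' g'
      exact ⟨rfl, rfl⟩
    | loop_false he' => exact absurd he' he
  | loop_false he =>
    intro s₂ t₂ h₂
    cases h₂ with
    | loop_true he' _ _ => exact absurd he he'
    | loop_false _ => exact ⟨rfl, rfl⟩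

/-- The initial memory on an input sequence: the input stands in `A_0`, everything else is zero. -/
def initial (w : List ℕ) : Memory :=
  fun a i => if a = 0 then w.getD i 0 else 0

/-- The size of an input sequence of natural numbers: the total binary length of its entries (one
more per entry, for separation). -/
def inputSize (w : List ℕ) : ℕ :=
  (w.map fun v => v.size + 1).sum

/-- A decision problem, with instances `x : X` encoded as sequences of natural numbers, is
polynomial-time solvable: one program halts on every instance within a number of steps that is
polynomial in the size of the encoded instance, and ends with `1` in the output cell `A_1[0]`
exactly on the yes-instances. -/
def PolyTimeSolvable {X : Type} (encode : X → List ℕ) (yes : X → Prop) : Prop :=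
  ∃ (p : Program) (T : Polynomial ℕ), ∀ x : X, ∃ (t : ℕ) (s : Memory),
    Exec p (initial (encode x)) t s ∧ t ≤ T.eval (inputSize (encode x)) ∧ (s 1 0 = 1 ↔ yes x)

end RAM

/-! ## Elections -/

namespace Election

/-- A preference (complete order) over the alternatives `Fin m`, given by the bijection that sends
an alternative to its position, counted from `0` at the top. -/
abbrev Preference (m : ℕ) := Fin m ≃ Fin m

/-- The alternative `a` is preferred over the alternative `b`. -/
def Preference.Prefers {m : ℕ} (P : Preference m) (a b : Fin m) : Prop := P a < P b

instance {m : ℕ} (P : Preference m) (a b : Fin m) : Decidable (P.Prefers a b) :=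
  inferInstanceAs (Decidable (P a < P b))

/-- The position of an alternative, counted from `1` at the top. -/
def Preference.pos {m : ℕ} (P : Preference m) (a : Fin m) : ℕ := (P a : ℕ) + 1

/-- The position of `a` is one more than the number of alternatives preferred over `a`. -/
theorem Preference.pos_eq {m : ℕ} (P : Preference m) (a : Fin m) :
    P.pos a = (Finset.univ.filter fun b => P.Prefers b a).card + 1 := by
  have h : (Finset.univ.filter fun b => P.Prefers b a) = (Finset.Iio (P a)).map
      P.symm.toEmbedding := by
    ext b
    rw [Finset.mem_filter]
    simp [Preference.Prefers]
  rw [h, Finset.card_map, Fin.card_Iio, Preference.pos]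

/-- A profile of `n` preferences. -/
abbrev Profile (m n : ℕ) := Fin n → Preference m

/-- A voting rule assigns to every profile its set of winners. -/
abbrev VotingRule := ∀ m n : ℕ, Profile m n → Finset (Fin m)

/-- The positional scoring rule in which, for `m` alternatives, the `i`-th position
(`1 ≤ i ≤ m`) is worth `α m i` points: the winners are the alternatives of maximum score. -/
def scoringRule (α : ℕ → ℕ → ℕ) : VotingRule := fun m n P =>
  let score : Fin m → ℕ := fun a => ∑ i : Fin n, α m ((P i).pos a)
  Finset.univ.filter fun a => ∀ b, score b ≤ score a

/-- The score vectors of `k`-approval, where `k` may depend on the number `m` of alternatives. -/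
def approvalVector (k : ℕ → ℕ) : ℕ → ℕ → ℕ := fun m i => if i ≤ k m then 1 else 0

/-- Plurality is `1`-approval. -/
def plurality : VotingRule := scoringRule (approvalVector fun _ => 1)

/-- Veto is `(m-1)`-approval. -/
def veto : VotingRule := scoringRule (approvalVector fun m => m - 1)

/-- A distance between preferences over the same alternatives. -/
abbrev Distance := ∀ m : ℕ, Preference m → Preference m → ℕ

/-- Swap distance: the number of pairs of alternatives ordered differently. Each such unordered pair
is counted once, as the ordered pair `(a, b)` with `a` preferred over `b` in the first preference. -/
def swapDistance : Distance := fun m P Q =>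
  (Finset.univ.filter fun ab : Fin m × Fin m => P.Prefers ab.1 ab.2 ∧ Q.Prefers ab.2 ab.1).card

/-- Footrule distance: the total displacement of the alternatives. -/
def footruleDistance : Distance := fun _ P Q =>
  ∑ a, ((P.pos a : ℤ) - (Q.pos a : ℤ)).natAbs

/-- Maximum displacement distance. -/
def maxDisplacementDistance : Distance := fun _ P Q =>
  Finset.univ.sup fun a => ((P.pos a : ℤ) - (Q.pos a : ℤ)).natAbs

/-- An instance of local distance constrained $ bribery. -/
structure BriberyInstance where
  /-- the number of alternatives -/
  m : ℕ
  /-- the number of voters -/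
  n : ℕ
  /-- there is at least one voter -/
  n_pos : 0 < n
  /-- the preferences of the voters -/
  profile : Profile m n
  /-- the distinguished alternative -/
  c : Fin m
  /-- the distance allowed for every voter -/
  δ : Fin n → ℕ
  /-- the price of every voter -/
  price : Fin n → ℕ
  /-- the budget -/
  budget : ℕ

/-- The encoding of an instance as a sequence of natural numbers: `m`, `n`, `c`, the budget, and
then for every voter `i` the numbers `δ i`, `price i` and the list of the alternatives from
the most preferred to the least preferred one. -/
def BriberyInstance.encode (I : BriberyInstance) : List ℕ :=
  [I.m, I.n, (I.c : ℕ), I.budget] ++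
    (List.finRange I.n).flatMap fun i =>
      [I.δ i, I.price i] ++ (List.finRange I.m).map fun k => ((I.profile i).symm k : ℕ)

/-- The question asked by local distance constrained $ bribery for the voting rule `r` and the
distance `d`: can the voters of some set `J` within the budget be given new preferences within their
distance bounds so that `c` becomes the unique winner? -/
def BriberyPossible (r : VotingRule) (d : Distance) (I : BriberyInstance) : Prop :=
  ∃ (J : Finset (Fin I.n)) (Q : Profile I.m I.n),
    ∑ i ∈ J, I.price i ≤ I.budget ∧
    (∀ i ∈ J, d I.m (I.profile i) (Q i) ≤ I.δ i) ∧
    r I.m I.n (fun i => if i ∈ J then Q i else I.profile i) = {I.c}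

/-- Local distance constrained $ bribery for the voting rule `r` and the distance `d` is solvable in
polynomial time. -/
def BriberyPolyTime (r : VotingRule) (d : Distance) : Prop :=
  RAM.PolyTimeSolvable BriberyInstance.encode (BriberyPossible r d)

end Election

/-!
Under each of the three distances, moving an alternative by `k` places to the top (for veto: to the
bottom) of a preference costs `k`, or `2 * k` for the footrule, and the move can be made at exactly
this cost (`Election.TopDistance`). Only the top, or bottom, alternatives matter for the winner,
so a bribery amounts to choosing an alternative for every voter: free of charge if it is his own,
at his price if it is near enough, and impossible otherwise (`Election.briberyPossible_iff`). The
alternative `c` is the unique winner if and only if for some bar `K` all counts are on the right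
side of it (`Election.beats_iff_exists_bar`).

For a fixed bar this is an assignment problem (`Bribery.solvable_iff`): every alternative gets
`n + 1` slots, dummies fill the slots that no voter takes, and the bar is enforced by forbidding
certain slots to the voters and certain others to the dummies. Forbidden pairs cost more than the
budget.

The assignment problem is solved by an auction with scaling. The matrix is multiplied by `N + 1`
and revealed digit by digit. In each phase the prices are doubled and all rows bid anew, always for
a column that is cheapest for them, counting entry plus price, and each bid raises the price of the
column by one. At the end of a phase every row holds a column that is cheapest for it up to `1`,
hence up to `3` at the start of the next one (`Auction.NearlyCheapest.double`). Comparing with the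
previous assignment shows that a row can only bid for columns whose price has risen by at most
`4 * N + 3` (`Auction.State.bid_price_le`), so a phase takes polynomially many bids. In the last
phase an error of `1` per row is too small to hide a better assignment, since all entries are
multiples of `N + 1` (`Auction.NearlyCheapest.sum_le`).

As for the logarithmic cost, it suffices to count instructions: the program never stores a product,
so that every instruction lengthens the stored numbers by a constant number of bits only
(`RAM.Steps.exec`). The instructions are counted in a program logic (`RAM.Runs`) together with the
proof of correctness (`Bribery.decideBribery_runs`).
-/

/-! ### Unit-cost runs and their logarithmic cost -/

namespace RAM

/-- `Steps p s k s'`: started in memory `s`, the program `p` halts in memory `s'` after executing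
`k` instructions; each test counts as one instruction, whatever the size of the numbers involved. -/
inductive Steps : Program → Memory → ℕ → Memory → Prop where
  | skip (s : Memory) : Steps .skip s 1 s
  | assign (s : Memory) (a : ℕ) (i e : Expr) :
      Steps (.assign a i e) s 1 (s.write a (i.eval s) (e.eval s))
  | seq {p q : Program} {s s' s'' : Memory} {k k' : ℕ} :
      Steps p s k s' → Steps q s' k' s'' → Steps (.seq p q) s (k + k' + 1) s''
  | cond_true {e : Expr} {p q : Program} {s s' : Memory} {k : ℕ} :
      e.eval s ≠ 0 → Steps p s k s' → Steps (.cond e p q) s (k + 1) s'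
  | cond_false {e : Expr} {p q : Program} {s s' : Memory} {k : ℕ} :
      e.eval s = 0 → Steps q s k s' → Steps (.cond e p q) s (k + 1) s'
  | loop_true {e : Expr} {p : Program} {s s' s'' : Memory} {k k' : ℕ} :
      e.eval s ≠ 0 → Steps p s k s' → Steps (.loop e p) s' k' s'' →
        Steps (.loop e p) s (k + k' + 1) s''
  | loop_false {e : Expr} {p : Program} {s : Memory} :
      e.eval s = 0 → Steps (.loop e p) s 1 s

/-- The number of nodes of an expression, a literal being counted with its binary length. -/
def Expr.weight : Expr → ℕ
  | .lit v => v.size + 1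
  | .get _ e => e.weight + 1
  | .add e f => e.weight + f.weight + 1
  | .sub e f => e.weight + f.weight + 1
  | .mul e f => e.weight + f.weight + 1
  | .div e f => e.weight + f.weight + 1

/-- An expression is tame if no product contributes to its value other than through the address of
a cell, a subtrahend or a divisor. The value of a tame expression is only a constant number
of bits longer than the contents of the memory. -/
def Expr.Tame : Expr → Prop
  | .lit _ => True
  | .get _ _ => True
  | .add e f => e.Tame ∧ f.Tame
  | .sub e _ => e.Tame
  | .mul _ _ => False
  | .div e _ => e.Tame

/-- A constant bounding the cost of every single instruction of a program relative to the length of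
the numbers in the memory. -/
def Program.weight : Program → ℕ
  | .skip => 1
  | .assign _ i e => i.weight ^ 2 + e.weight ^ 2 + 1
  | .seq p q => p.weight + q.weight + 1
  | .cond e p q => e.weight ^ 2 + 1 + p.weight + q.weight
  | .loop e p => e.weight ^ 2 + 1 + p.weight

/-- A program is tame if it stores the values of tame expressions only. -/
def Program.Tame : Program → Prop
  | .skip => True
  | .assign _ _ e => e.Tame
  | .seq p q => p.Tame ∧ q.Tame
  | .cond _ p q => p.Tame ∧ q.Tame
  | .loop _ p => p.Tame

/-- All numbers in the memory have binary length at most `L`. -/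
def Memory.Bounded (s : Memory) (L : ℕ) : Prop := ∀ a i, (s a i).size ≤ L

theorem size_add_le {x y a : ℕ} (hx : x.size ≤ a) (hy : y.size ≤ a) : (x + y).size ≤ a + 1 := by
  rw [Nat.size_le] at *
  rw [pow_succ]; omega

theorem size_mul_le (x y : ℕ) : (x * y).size ≤ x.size + y.size := by
  rw [Nat.size_le, pow_add]
  exact Nat.mul_lt_mul'' x.lt_size_self y.lt_size_self

theorem Expr.one_le_weight (e : Expr) : 1 ≤ e.weight := by
  cases e <;> simp [Expr.weight]

theorem Expr.size_eval_le_add {s : Memory} {L : ℕ} (hs : s.Bounded L) (e : Expr) (he : e.Tame) :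
    (e.eval s).size ≤ L + e.weight := by
  induction e with
  | lit v => simp only [Expr.eval, Expr.weight]; omega
  | get a e _ => exact (hs _ _).trans (by omega)
  | add e f ihe ihf =>
    refine (size_add_le (a := L + e.weight + f.weight) ((ihe he.1).trans (by omega))
      ((ihf he.2).trans (by omega))).trans ?_
    simp only [Expr.weight]; omega
  | sub e f ihe _ =>
    refine (Nat.size_le_size (Nat.sub_le _ _)).trans ((ihe he).trans ?_)
    simp only [Expr.weight]; omega
  | mul e f _ _ => exact he.elim
  | div e f ihe _ =>
    refine (Nat.size_le_size (Nat.div_le_self _ _)).trans ((ihe he).trans ?_)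
    simp only [Expr.weight]; omega

theorem Expr.size_eval_le_mul {s : Memory} {L : ℕ} (hs : s.Bounded L) (e : Expr) :
    (e.eval s).size ≤ e.weight * (L + 1) := by
  induction e with
  | lit v => simp only [Expr.eval, Expr.weight]; nlinarith
  | get a e _ => refine (hs _ _).trans ?_; simp only [Expr.weight]; nlinarith
  | add e f ihe ihf =>
    refine (size_add_le (a := e.weight * (L + 1) + f.weight * (L + 1)) (ihe.trans (by omega))
      (ihf.trans (by omega))).trans ?_
    simp only [Expr.weight]; nlinarith
  | sub e f ihe _ =>
    refine (Nat.size_le_size (Nat.sub_le _ _)).trans (ihe.trans ?_)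
    exact Nat.mul_le_mul_right _ (by simp only [Expr.weight]; omega)
  | mul e f ihe ihf =>
    refine (size_mul_le _ _).trans ((Nat.add_le_add ihe ihf).trans ?_)
    simp only [Expr.weight]; nlinarith
  | div e f ihe _ =>
    refine (Nat.size_le_size (Nat.div_le_self _ _)).trans (ihe.trans ?_)
    exact Nat.mul_le_mul_right _ (by simp only [Expr.weight]; omega)

theorem Expr.cost_le {s : Memory} {L : ℕ} (hs : s.Bounded L) (e : Expr) :
    e.cost s ≤ e.weight ^ 2 * (L + 2) := by
  have binary (a b c d z : ℕ) (hc : c ≤ a ^ 2 * (L + 2)) (hd : d ≤ b ^ 2 * (L + 2))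
      (hz : z ≤ (a + b + 1) * (L + 1)) : c + d + z + 1 ≤ (a + b + 1) ^ 2 * (L + 2) := by
    have : (a + b + 1) ^ 2 * (L + 2) =
      a ^ 2 * (L + 2) + b ^ 2 * (L + 2) + (a + b + 1) * (L + 1) + 1 +
        ((a + b) * (L + 3) + 2 * a * b * (L + 2)) := by ring
    omega
  induction e with
  | lit v => simp only [Expr.cost, Expr.weight]; nlinarith
  | get a e ih =>
    have h := binary e.weight 0 _ 0 (s a (e.eval s)).size ih (by simp)
      ((hs _ _).trans (by nlinarith))
    simpa [Expr.cost, Expr.weight] using h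
  | add e f ihe ihf => exact binary _ _ _ _ _ ihe ihf (Expr.size_eval_le_mul hs (.add e f))
  | sub e f ihe ihf => exact binary _ _ _ _ _ ihe ihf (Expr.size_eval_le_mul hs (.sub e f))
  | mul e f ihe ihf => exact binary _ _ _ _ _ ihe ihf (Expr.size_eval_le_mul hs (.mul e f))
  | div e f ihe ihf => exact binary _ _ _ _ _ ihe ihf (Expr.size_eval_le_mul hs (.div e f))

theorem Memory.Bounded.mono {s : Memory} {L L' : ℕ} (hs : s.Bounded L) (h : L ≤ L') :
    s.Bounded L' := fun a i => (hs a i).trans h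

/-- A tame program executes its `k` instructions at a logarithmic cost that is polynomial in `k` and
in the length of the numbers initially stored, because every instruction lengthens the numbers in
the memory by a constant number of bits only. -/
theorem Steps.exec {p : Program} {s s' : Memory} {k : ℕ} (h : Steps p s k s') (c : ℕ)
    (hc : p.weight ≤ c) (hp : p.Tame) (L : ℕ) (hs : s.Bounded L) :
    (∃ t, Exec p s t s' ∧ t ≤ k * (c * (L + c * k + 2))) ∧ s'.Bounded (L + c * k) := by
  -- Two consecutive pieces of a run, together with one instruction of their own.
  have glue (L c w k k' t t' : ℕ) (hw : w + 1 ≤ c) (ht : t ≤ k * (c * (L + c * k + 2)))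
      (ht' : t' ≤ k' * (c * (L + c * k + c * k' + 2))) :
      w * (L + 2) + t + t' + 1 ≤ (k + k' + 1) * (c * (L + c * (k + k' + 1) + 2)) := by
    have h1 : k * (c * (L + c * k + 2)) ≤ k * (c * (L + c * (k + k' + 1) + 2)) := by
      gcongr; omega
    have h2 : k' * (c * (L + c * k + c * k' + 2)) ≤ k' * (c * (L + c * (k + k' + 1) + 2)) := by
      have : c * k + c * k' ≤ c * (k + k' + 1) := by nlinarith
      exact Nat.mul_le_mul_left _ (Nat.mul_le_mul_left _ (by omega))
    have h3 : w * (L + 2) + 1 ≤ c * (L + c * (k + k' + 1) + 2) := by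
      calc w * (L + 2) + 1 ≤ (w + 1) * (L + 2) := by nlinarith
        _ ≤ c * (L + c * (k + k' + 1) + 2) := Nat.mul_le_mul hw (by omega)
    have : (k + k' + 1) * (c * (L + c * (k + k' + 1) + 2)) =
      k * (c * (L + c * (k + k' + 1) + 2)) + k' * (c * (L + c * (k + k' + 1) + 2)) +
        c * (L + c * (k + k' + 1) + 2) := by ring
    omega
  induction h generalizing L with
  | skip s =>
    refine ⟨⟨1, .skip s, ?_⟩, hs.mono (by omega)⟩
    simp only [Program.weight] at hc; nlinarith
  | assign s a i e =>
    simp only [Program.weight] at hc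
    refine ⟨⟨_, .assign s a i e, ?_⟩, ?_⟩
    · have := glue L c (i.weight ^ 2 + e.weight ^ 2) 0 0 0 0 hc (by simp) (by simp)
      have h1 := Expr.cost_le hs i
      have h2 := Expr.cost_le hs e
      rw [add_mul] at this
      simp only [zero_add, add_zero] at this
      omega
    · intro b j
      unfold Memory.write
      split_ifs
      · refine (Expr.size_eval_le_add hs e hp).trans ?_
        have := e.one_le_weight
        nlinarith
      · exact (hs _ _).trans (by omega)
  | seq _ _ ih ih' =>
    simp only [Program.weight] at hc
    obtain ⟨⟨t, h1, h2⟩, h3⟩ := ih (by omega) hp.1 L hs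
    obtain ⟨⟨t', h1', h2'⟩, h3'⟩ := ih' (by omega) hp.2 _ h3
    refine ⟨⟨_, .seq h1 h1', ?_⟩, h3'.mono (by nlinarith)⟩
    have := glue L c 0 _ _ _ _ (by omega) h2 h2'
    omega
  | @cond_true e _ _ _ _ _ he _ ih =>
    simp only [Program.weight] at hc
    obtain ⟨⟨t, h1, h2⟩, h3⟩ := ih (by omega) hp.1 L hs
    refine ⟨⟨_, .cond_true he h1, ?_⟩, h3.mono (by nlinarith)⟩
    have := glue L c (e.weight ^ 2) _ 0 _ 0 (by omega : e.weight ^ 2 + 1 ≤ c) h2 (by simp)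
    have h4 := Expr.cost_le hs e
    simp only [add_zero] at this
    exact le_trans (by gcongr) this
  | @cond_false e _ _ _ _ _ he _ ih =>
    simp only [Program.weight] at hc
    obtain ⟨⟨t, h1, h2⟩, h3⟩ := ih (by omega) hp.2 L hs
    refine ⟨⟨_, .cond_false he h1, ?_⟩, h3.mono (by nlinarith)⟩
    have := glue L c (e.weight ^ 2) _ 0 _ 0 (by omega : e.weight ^ 2 + 1 ≤ c) h2 (by simp)
    have h4 := Expr.cost_le hs e
    simp only [add_zero] at this
    exact le_trans (by gcongr) this
  | @loop_true e _ _ _ _ _ _ he _ _ ih ih' =>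
    obtain ⟨⟨t, h1, h2⟩, h3⟩ := ih (by simp only [Program.weight] at hc; omega) hp L hs
    obtain ⟨⟨t', h1', h2'⟩, h3'⟩ := ih' hc hp _ h3
    simp only [Program.weight] at hc
    refine ⟨⟨_, .loop_true he h1 h1', ?_⟩, h3'.mono (by nlinarith)⟩
    have := glue L c (e.weight ^ 2) _ _ _ _ (by omega : e.weight ^ 2 + 1 ≤ c) h2 h2'
    have h4 := Expr.cost_le hs e
    exact le_trans (by gcongr) this
  | @loop_false e _ _ he =>
    simp only [Program.weight] at hc
    refine ⟨⟨_, .loop_false he, ?_⟩, hs.mono (by omega)⟩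
    have := glue L c (e.weight ^ 2) 0 0 0 0 (by omega : e.weight ^ 2 + 1 ≤ c) (by simp) (by simp)
    have h4 := Expr.cost_le hs e
    simp only [add_zero, zero_add] at this
    exact le_trans (by gcongr) this

/-! ### A program logic with step bounds -/

/-- The arrays that a program may write to. -/
def Program.mods : Program → List ℕ
  | .skip => []
  | .assign a _ _ => [a]
  | .seq p q => p.mods ++ q.mods
  | .cond _ p q => p.mods ++ q.mods
  | .loop _ p => p.mods

theorem Steps.frame {p : Program} {s s' : Memory} {k : ℕ} (h : Steps p s k s') :
    ∀ a, a ∉ p.mods → s' a = s a := by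
  induction h with
  | skip s => intro a _; rfl
  | assign s a i e =>
    intro b hb
    funext j
    simp only [Program.mods, List.mem_singleton] at hb
    simp [Memory.write, hb]
  | seq _ _ ih ih' =>
    intro a ha
    simp only [Program.mods, List.mem_append, not_or] at ha
    rw [ih' a ha.2, ih a ha.1]
  | cond_true _ _ ih =>
    intro a ha
    simp only [Program.mods, List.mem_append, not_or] at ha
    exact ih a ha.1
  | cond_false _ _ ih =>
    intro a ha
    simp only [Program.mods, List.mem_append, not_or] at ha
    exact ih a ha.2
  | loop_true _ _ _ ih ih' => intro a ha; rw [ih' a ha, ih a ha]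
  | loop_false _ => intro a _; rfl

/-- Started in memory `s`, the program `p` halts after at most `k` instructions in a memory that
satisfies `Q`. -/
def Runs (p : Program) (s : Memory) (k : ℕ) (Q : Memory → Prop) : Prop :=
  ∃ k' s', Steps p s k' s' ∧ k' ≤ k ∧ Q s'

theorem Runs.mono {p : Program} {s : Memory} {k k' : ℕ} {Q Q' : Memory → Prop}
    (h : Runs p s k Q) (hk : k ≤ k') (hQ : ∀ s', (∀ a, a ∉ p.mods → s' a = s a) → Q s' → Q' s') :
    Runs p s k' Q' := by
  obtain ⟨l, s', h1, h2, h3⟩ := h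
  exact ⟨l, s', h1, h2.trans hk, hQ s' h1.frame h3⟩

theorem Runs.skip {s : Memory} {Q : Memory → Prop} (h : Q s) : Runs .skip s 1 Q :=
  ⟨1, s, .skip s, le_rfl, h⟩

theorem Runs.assign {a : ℕ} {i e : Expr} {s : Memory} {Q : Memory → Prop}
    (h : Q (s.write a (i.eval s) (e.eval s))) : Runs (.assign a i e) s 1 Q :=
  ⟨1, _, .assign s a i e, le_rfl, h⟩

theorem Runs.seq {p q : Program} {s : Memory} {k k' : ℕ} {Q : Memory → Prop}
    (h : Runs p s k fun s' => Runs q s' k' Q) : Runs (.seq p q) s (k + k' + 1) Q := by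
  obtain ⟨l, s', h1, h2, l', s'', h3, h4, h5⟩ := h
  exact ⟨_, s'', .seq h1 h3, by omega, h5⟩

theorem Runs.assign_seq {a : ℕ} {i e : Expr} {q : Program} {s : Memory} {k : ℕ}
    {Q : Memory → Prop} (h : Runs q (s.write a (i.eval s) (e.eval s)) k Q) :
    Runs (.seq (.assign a i e) q) s (k + 2) Q :=
  (Runs.seq (k := 1) (k' := k) (Runs.assign h)).mono (by omega) fun _ _ h => h

theorem Runs.cond {e : Expr} {p q : Program} {s : Memory} {k : ℕ} {Q : Memory → Prop}
    (h : e.eval s ≠ 0 → Runs p s k Q) (h' : e.eval s = 0 → Runs q s k Q) :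
    Runs (.cond e p q) s (k + 1) Q := by
  by_cases he : e.eval s = 0
  · obtain ⟨l, s', h1, h2, h3⟩ := h' he
    exact ⟨_, s', .cond_false he h1, by omega, h3⟩
  · obtain ⟨l, s', h1, h2, h3⟩ := h he
    exact ⟨_, s', .cond_true he h1, by omega, h3⟩

/-- The rule for while loops: `Inv` is an invariant and `μ` a termination measure. -/
theorem Runs.loop {e : Expr} {p : Program} {k : ℕ} {Q : Memory → Prop}
    (Inv : Memory → Prop) (μ : Memory → ℕ) (M : ℕ) {s : Memory}
    (step : ∀ s', (∀ a, a ∉ p.mods → s' a = s a) → Inv s' → e.eval s' ≠ 0 →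
      Runs p s' k fun s'' => Inv s'' ∧ μ s'' < μ s')
    (done : ∀ s', (∀ a, a ∉ p.mods → s' a = s a) → Inv s' → e.eval s' = 0 → Q s')
    (h0 : Inv s) (hM : μ s ≤ M) : Runs (.loop e p) s (M * (k + 1) + 1) Q := by
  suffices H : ∀ M s', (∀ a, a ∉ p.mods → s' a = s a) → Inv s' → μ s' ≤ M →
      Runs (.loop e p) s' (M * (k + 1) + 1) Q from H M s (fun _ _ => rfl) h0 hM
  intro M
  induction M with
  | zero =>
    intro s' hf hI hμ
    by_cases he : e.eval s' = 0
    · exact ⟨1, s', .loop_false he, by omega, done s' hf hI he⟩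
    · obtain ⟨_, _, _, _, _, h⟩ := step s' hf hI he
      omega
  | succ M ih =>
    intro s' hf hI hμ
    by_cases he : e.eval s' = 0
    · exact ⟨1, s', .loop_false he, by omega, done s' hf hI he⟩
    · obtain ⟨l, s'', h1, h2, h3, h4⟩ := step s' hf hI he
      obtain ⟨l', s''', h1', h2', h3'⟩ := ih s''
        (fun a ha => (h1.frame a ha).trans (hf a ha)) h3 (by omega)
      exact ⟨_, s''', .loop_true he h1 h1', by rw [add_mul]; omega, h3'⟩

/-- The value of a scalar variable, which is kept in the first cell of an array of its own. -/
abbrev Expr.var (x : ℕ) : Expr := .get x (.lit 0)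

/-- The assignment to a scalar variable. -/
abbrev Program.set (x : ℕ) (e : Expr) : Program := .assign x (.lit 0) e

/-- The loop in which the variable `x` runs from `0` up to, but excluding, the value of `b`. -/
def Program.forLoop (x b : ℕ) (p : Program) : Program :=
  .seq (.set x (.lit 0)) (.loop (.sub (.var b) (.var x))
    (.seq p (.set x (.add (.var x) (.lit 1)))))

/-- The rule for counting loops: `Inv i` holds before the pass in which the counter is `i`. -/
theorem Runs.forLoop {x b : ℕ} {p : Program} {k : ℕ} {Q : Memory → Prop} {s : Memory} (n M : ℕ)
    (Inv : ℕ → Memory → Prop) (hn : s b 0 = n) (hM : n ≤ M)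
    (hx : x ∉ p.mods) (hb : b ∉ p.mods) (hxb : b ≠ x)
    (h0 : Inv 0 (s.write x 0 0))
    (step : ∀ i s', i < n → s' x 0 = i → (∀ a, a ≠ x → a ∉ p.mods → s' a = s a) → Inv i s' →
      Runs p s' k fun s'' => Inv (i + 1) (s''.write x 0 (i + 1)))
    (done : ∀ s', (∀ a, a ≠ x → a ∉ p.mods → s' a = s a) → Inv n s' → Q s') :
    Runs (.forLoop x b p) s (M * (k + 3) + 3) Q := by
  have key : ∀ s' : Memory, (∀ a, a ∉ (Program.seq p (.set x (.add (.var x) (.lit 1)))).mods →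
      s' a = s.write x 0 0 a) → ∀ a, a ≠ x → a ∉ p.mods → s' a = s a := by
    intro s' h a hax hap
    rw [h a (by simp [Program.mods, hax, hap])]
    funext j
    simp [Memory.write, hax]
  have := Runs.assign_seq (a := x) (i := .lit 0) (e := .lit 0) (s := s)
    (Runs.loop (e := .sub (.var b) (.var x))
      (p := .seq p (.set x (.add (.var x) (.lit 1)))) (k := k + 2) (Q := Q)
      (fun s' => Inv (s' x 0) s' ∧ s' x 0 ≤ n) (fun s' => n - s' x 0) M ?_ ?_ ?_ ?_)
  · exact this.mono (by ring_nf; omega) fun _ _ h => h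
  · intro s' hf hI he
    have hf' := key s' hf
    have hb' : s' b 0 = n := by rw [hf' b hxb hb, hn]
    simp only [Expr.eval, hb'] at he
    have hs := step (s' x 0) s' (by omega) rfl hf' hI.1
    refine (Runs.seq (k := k) (k' := 1) (hs.mono le_rfl ?_)).mono (by omega) fun _ _ h => h
    intro s'' hf'' hI''
    refine Runs.assign ?_
    have hx' : s'' x 0 = s' x 0 := by rw [hf'' x hx]
    simp only [Expr.eval, hx']
    refine ⟨⟨?_, ?_⟩, ?_⟩
    · simpa [Memory.write] using hI''
    · simp [Memory.write]; omega
    · simp [Memory.write]; omega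
  · intro s' hf hI he
    have hf' := key s' hf
    have hb' : s' b 0 = n := by rw [hf' b hxb hb, hn]
    simp only [Expr.eval, hb'] at he
    have : s' x 0 = n := by omega
    exact done s' hf' (this ▸ hI.1)
  · simpa [Memory.write, Expr.eval] using h0
  · simpa [Memory.write, Expr.eval] using hM

end RAM

/-! ### The auction algorithm for the assignment problem -/

namespace Auction

open Finset

/-- `π` is a bijection from the rows `0, …, N-1` of a matrix to its columns. -/
structure IsAssignment (N : ℕ) (π : ℕ → ℕ) : Prop where
  lt : ∀ r < N, π r < N
  inj : ∀ r < N, ∀ r' < N, π r = π r' → r = r'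

theorem IsAssignment.image {N : ℕ} {π : ℕ → ℕ} (h : IsAssignment N π) :
    (range N).image π = range N := by
  refine eq_of_subset_of_card_le ?_ ?_
  · intro x hx
    simp only [mem_image, mem_range] at hx ⊢
    obtain ⟨r, hr, rfl⟩ := hx
    exact h.lt r hr
  · rw [card_image_of_injOn]
    intro a ha b hb hab
    simp only [coe_range, Set.mem_Iio] at ha hb
    exact h.inj a ha b hb hab

theorem IsAssignment.sum_comp {N : ℕ} {π : ℕ → ℕ} (h : IsAssignment N π) (f : ℕ → ℕ) :
    ∑ r ∈ range N, f (π r) = ∑ j ∈ range N, f j := by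
  conv_rhs => rw [← h.image]
  rw [sum_image]
  intro a ha b hb hab
  simp only [coe_range, Set.mem_Iio] at ha hb
  exact h.inj a ha b hb hab

/-- For the column prices `v`, every row is assigned by `π` to a column that is cheapest for it up
to `ε`, where a column costs a row the matrix entry plus the price. -/
def NearlyCheapest (N : ℕ) (C : ℕ → ℕ → ℕ) (v π : ℕ → ℕ) (ε : ℕ) : Prop :=
  ∀ r < N, ∀ k < N, C r (π r) + v (π r) ≤ C r k + v k + ε

/-- Complementary slackness with error `1` is exact optimality when all entries are multiples of
`N + 1`. -/
theorem NearlyCheapest.sum_le {N : ℕ} {W : ℕ → ℕ → ℕ} {v π σ : ℕ → ℕ}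
    (h : NearlyCheapest N (fun r k => W r k * (N + 1)) v π 1) (hπ : IsAssignment N π)
    (hσ : IsAssignment N σ) :
    ∑ r ∈ range N, W r (π r) ≤ ∑ r ∈ range N, W r (σ r) := by
  have h1 : ∑ r ∈ range N, (W r (π r) * (N + 1) + v (π r)) ≤
      ∑ r ∈ range N, (W r (σ r) * (N + 1) + v (σ r) + 1) :=
    sum_le_sum fun r hr => h r (mem_range.1 hr) _ (hσ.lt r (mem_range.1 hr))
  simp only [sum_add_distrib, hπ.sum_comp v, hσ.sum_comp v, ← sum_mul, sum_const, card_range,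
    smul_eq_mul, mul_one] at h1
  by_contra hlt
  have : (∑ r ∈ range N, W r (σ r) + 1) * (N + 1) ≤ (∑ r ∈ range N, W r (π r)) * (N + 1) :=
    Nat.mul_le_mul_right _ (by omega)
  rw [add_mul] at this
  omega

/-- Doubling the entries of the matrix, up to a last binary digit, and the prices at most triples
the error. -/
theorem NearlyCheapest.double {N : ℕ} {C C' : ℕ → ℕ → ℕ} {v π : ℕ → ℕ}
    (h : NearlyCheapest N C v π 1)
    (hC : ∀ r < N, ∀ k < N, 2 * C r k ≤ C' r k ∧ C' r k ≤ 2 * C r k + 1)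
    (hπ : IsAssignment N π) :
    NearlyCheapest N C' (fun j => v j + v j) π 3 := by
  intro r hr k hk
  have h1 := h r hr k hk
  have h2 := hC r hr k hk
  have h3 := hC r hr _ (hπ.lt r hr)
  dsimp only
  omega

/-- The state of an auction on the matrix `C` that started from the prices `v₀`. The rows are
numbered from `1`. The rows `1, …, r` have entered; `own j` is the row that holds the column `j`,
or `0`; `cur` is the row among those entered that holds no column, or `0`. -/
structure State (N : ℕ) (C : ℕ → ℕ → ℕ) (v₀ v own : ℕ → ℕ) (r cur : ℕ) : Prop where
  le_price : ∀ j < N, v₀ j ≤ v j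
  free : ∀ j < N, own j = 0 → v j = v₀ j
  slack : ∀ j < N, own j ≠ 0 → ∀ k < N, C (own j - 1) j + v j ≤ C (own j - 1) k + v k + 1
  inj : ∀ j < N, ∀ k < N, own j ≠ 0 → own j = own k → j = k
  own_le : ∀ j < N, own j ≤ r
  cur_le : cur ≤ r
  own_ne : ∀ j < N, own j ≠ 0 → own j ≠ cur
  surj : ∀ x, 1 ≤ x → x ≤ r → x = cur ∨ ∃ j < N, own j = x

variable {N : ℕ} {C : ℕ → ℕ → ℕ} {v₀ v own : ℕ → ℕ} {r cur : ℕ}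

theorem State.init (hv : ∀ j < N, v j = v₀ j) (hown : ∀ j < N, own j = 0) :
    State N C v₀ v own 0 0 where
  le_price j hj := (hv j hj).ge
  free j hj _ := hv j hj
  slack j hj h := absurd (hown j hj) h
  inj j hj _ _ h := absurd (hown j hj) h
  own_le j hj := (hown j hj).le
  cur_le := le_rfl
  own_ne j hj h := absurd (hown j hj) h
  surj x h h' := by omega

theorem State.enter (h : State N C v₀ v own r 0) : State N C v₀ v own (r + 1) (r + 1) where
  le_price := h.le_price
  free := h.free
  slack := h.slack
  inj := h.inj
  own_le j hj := (h.own_le j hj).trans (by omega)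
  cur_le := le_rfl
  own_ne j hj _ := by have := h.own_le j hj; omega
  surj x h1 h2 := by
    rcases Nat.lt_or_ge r x with hx | hx
    · left; omega
    · rcases h.surj x h1 hx with h3 | h3
      · omega
      · exact Or.inr h3

/-- Summing the two slackness conditions along an old assignment `π`, over all columns held by
some row, shows that the column of the row `cur` under `π` has become dearer by at most `4 * N`:
only columns that are held have become dearer at all. -/
theorem State.price_le (h : State N C v₀ v own r cur) (hr : r ≤ N) (hcur : cur ≠ 0)
    {π : ℕ → ℕ} (hπ : IsAssignment N π) (hC : NearlyCheapest N C v₀ π 3) :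
    v (π (cur - 1)) ≤ v₀ (π (cur - 1)) + 4 * N := by
  classical
  set D : ℕ → ℕ := fun j => v j - v₀ j with hD
  set A := (range N).filter fun j => own j ≠ 0 with hA
  have hAmem : ∀ j ∈ A, j < N ∧ own j ≠ 0 := fun j hj => by simpa [hA] using hj
  have hrow : ∀ j ∈ A, own j - 1 < N := fun j hj => by
    have := h.own_le j (hAmem j hj).1
    have := (hAmem j hj).2
    omega
  have hc : cur - 1 < N := by have := h.cur_le; omega
  have h1 : ∑ j ∈ A, D j ≤ ∑ j ∈ A, (D (π (own j - 1)) + 4) := by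
    refine sum_le_sum fun j hj => ?_
    obtain ⟨hj1, hj2⟩ := hAmem j hj
    have hp := hπ.lt _ (hrow j hj)
    have e1 := h.slack j hj1 hj2 _ hp
    have e2 := hC _ (hrow j hj) j hj1
    have e3 := h.le_price j hj1
    have e4 := h.le_price _ hp
    simp only [hD]
    omega
  have hinj : Set.InjOn (fun j => π (own j - 1)) A := by
    intro a ha b hb hab
    have ha' := hAmem a ha
    have hb' := hAmem b hb
    have := hπ.inj _ (hrow a ha) _ (hrow b hb) hab
    exact h.inj a ha'.1 b hb'.1 ha'.2 (by omega)
  have hnot : π (cur - 1) ∉ A.image fun j => π (own j - 1) := by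
    intro hmem
    obtain ⟨j, hj, hj'⟩ := mem_image.1 hmem
    have := hπ.inj _ (hrow j hj) _ hc hj'
    have h2 := (hAmem j hj).2
    exact h.own_ne j (hAmem j hj).1 h2 (by omega)
  have h2 : D (π (cur - 1)) + ∑ j ∈ A, D (π (own j - 1)) ≤ ∑ j ∈ range N, D j := by
    rw [← sum_image (f := D) hinj, ← sum_insert hnot]
    refine sum_le_sum_of_subset ?_
    intro x hx
    rcases mem_insert.1 hx with rfl | hx
    · exact mem_range.2 (hπ.lt _ hc)
    · obtain ⟨j, hj, rfl⟩ := mem_image.1 hx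
      exact mem_range.2 (hπ.lt _ (hrow j hj))
  have h3 : ∑ j ∈ range N, D j = ∑ j ∈ A, D j := by
    rw [hA, sum_filter]
    refine sum_congr rfl fun j hj => ?_
    split_ifs with hj'
    · rfl
    · have := h.free j (mem_range.1 hj) (by simpa using hj')
      simp [hD, this]
  have h4 : A.card ≤ N := (card_filter_le _ _).trans (by simp)
  rw [sum_add_distrib, sum_const, smul_eq_mul] at h1
  have h5 := h.le_price _ (hπ.lt _ hc)
  have h6 : D (π (cur - 1)) ≤ 4 * N := by omega
  simp only [hD] at h6
  omega

/-- The row `cur` only bids for columns that have become dearer by at most `4 * N + 3`: any other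
column costs it more than its column under the old assignment `π`. -/
theorem State.bid_price_le (h : State N C v₀ v own r cur) (hr : r ≤ N) (hcur : cur ≠ 0)
    {π : ℕ → ℕ} (hπ : IsAssignment N π) (hC : NearlyCheapest N C v₀ π 3) {b : ℕ} (hb : b < N)
    (hmin : ∀ k < N, C (cur - 1) b + v b ≤ C (cur - 1) k + v k) :
    v b ≤ v₀ b + 4 * N + 3 := by
  have hc : cur - 1 < N := by have := h.cur_le; omega
  have h1 := h.price_le hr hcur hπ hC
  have h2 := hmin _ (hπ.lt _ hc)
  have h3 := hC _ hc b hb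
  omega

theorem State.bid (h : State N C v₀ v own r cur) (hcur : cur ≠ 0) {b : ℕ} (hb : b < N)
    (hmin : ∀ k < N, C (cur - 1) b + v b ≤ C (cur - 1) k + v k) :
    State N C v₀ (Function.update v b (v b + 1)) (Function.update own b cur) r (own b) where
  le_price j hj := by
    have := h.le_price j hj
    rcases eq_or_ne j b with rfl | hjb
    · simp; omega
    · simpa [hjb] using this
  free j hj hj' := by
    rcases eq_or_ne j b with rfl | hjb
    · simp at hj'; exact absurd hj' hcur
    · simp only [Function.update_of_ne hjb] at hj' ⊢
      exact h.free j hj hj'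
  slack j hj hj' k hk := by
    have hv : v k ≤ Function.update v b (v b + 1) k := by
      rcases eq_or_ne k b with rfl | hkb
      · simp
      · simp [hkb]
    rcases eq_or_ne j b with rfl | hjb
    · simp only [Function.update_self]
      have := hmin k hk
      omega
    · simp only [Function.update_of_ne hjb] at hj' ⊢
      have := h.slack j hj hj' k hk
      omega
  inj j hj k hk hj' hjk := by
    rcases eq_or_ne j b with rfl | hjb
    · rcases eq_or_ne k j with rfl | hkb
      · rfl
      · simp only [Function.update_self, Function.update_of_ne hkb] at hjk
        exact absurd hjk.symm (h.own_ne k hk (by omega))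
    · rcases eq_or_ne k b with rfl | hkb
      · simp only [Function.update_self, Function.update_of_ne hjb] at hjk hj'
        exact absurd hjk (h.own_ne j hj hj')
      · simp only [Function.update_of_ne hkb, Function.update_of_ne hjb] at hjk hj'
        exact h.inj j hj k hk hj' hjk
  own_le j hj := by
    rcases eq_or_ne j b with rfl | hjb
    · simpa using h.cur_le
    · simpa [hjb] using h.own_le j hj
  cur_le := h.own_le b hb
  own_ne j hj hj' hjo := by
    rcases eq_or_ne j b with rfl | hjb
    · simp only [Function.update_self] at hjo
      exact h.own_ne j hj (by omega) hjo.symm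
    · simp only [Function.update_of_ne hjb] at hjo hj'
      exact hjb (h.inj j hj b hb hj' hjo)
  surj x h1 h2 := by
    rcases h.surj x h1 h2 with rfl | ⟨j, hj, rfl⟩
    · exact Or.inr ⟨b, hb, by simp⟩
    · rcases eq_or_ne j b with rfl | hjb
      · exact Or.inl rfl
      · exact Or.inr ⟨j, hj, by simp [hjb]⟩

/-- The number of bids still possible, summed over all columns: no bid is made at a price above
`v₀ j + 4 * N + 3`. -/
def potential (N : ℕ) (v₀ v : ℕ → ℕ) : ℕ := ∑ j ∈ range N, (v₀ j + 4 * N + 4 - v j)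

theorem State.potential_le (h : State N C v₀ v own r cur) :
    potential N v₀ v ≤ N * (4 * N + 4) := by
  calc potential N v₀ v ≤ ∑ _j ∈ range N, (4 * N + 4) :=
        sum_le_sum fun j hj => by have := h.le_price j (mem_range.1 hj); omega
    _ = N * (4 * N + 4) := by simp

theorem potential_update_lt {b : ℕ} (hb : b < N) (h : v b ≤ v₀ b + 4 * N + 3) :
    potential N v₀ (Function.update v b (v b + 1)) < potential N v₀ v := by
  refine sum_lt_sum (fun j _ => ?_) ⟨b, mem_range.2 hb, ?_⟩
  · rcases eq_or_ne j b with rfl | hjb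
    · simp only [Function.update_self]; omega
    · simp [hjb]
  · simp only [Function.update_self]; omega

/-- When all rows have entered and each of them holds a column, the columns held form an assignment
with inverse `own`; sums over it can be taken column by column. -/
theorem State.finish (h : State N C v₀ v own N 0) :
    ∃ π, IsAssignment N π ∧ NearlyCheapest N C v π 1 ∧ (∀ j < N, own j - 1 < N) ∧
      ∀ f : ℕ → ℕ → ℕ, ∑ j ∈ range N, f (own j - 1) j = ∑ r ∈ range N, f r (π r) := by
  have hex : ∀ r, ∃ j, r < N → j < N ∧ own j = r + 1 := by
    intro r
    by_cases hr : r < N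
    · rcases h.surj (r + 1) (by omega) hr with h1 | ⟨j, hj⟩
      · omega
      · exact ⟨j, fun _ => hj⟩
    · exact ⟨0, fun h => absurd h hr⟩
  choose π hπ using hex
  have hass : IsAssignment N π :=
    ⟨fun r hr => (hπ r hr).1, fun r hr r' hr' he => by
      have h1 := (hπ r hr).2
      have h2 := (hπ r' hr').2
      rw [he] at h1
      omega⟩
  refine ⟨π, hass, ?_, fun j hj => by have := h.own_le j hj; omega, fun f => ?_⟩
  · intro r hr k hk
    obtain ⟨h1, h2⟩ := hπ r hr
    have := h.slack (π r) h1 (by omega) k hk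
    simpa [h2] using this
  · rw [← hass.sum_comp fun j => f (own j - 1) j]
    refine sum_congr rfl fun r hr => ?_
    rw [(hπ r (mem_range.1 hr)).2]
    simp

end Auction

/-! ### The auction as a program -/

namespace RAM

theorem Memory.write_self (s : Memory) (a i v : ℕ) :
    s.write a i v a = Function.update (s a) i v := by
  funext j
  by_cases h : j = i <;> simp [Memory.write, h]

theorem Memory.write_of_ne (s : Memory) {a b : ℕ} (i v : ℕ) (h : b ≠ a) :
    s.write a i v b = s b := by
  funext j
  simp [Memory.write, h]

end RAM

/- The arrays used by the programs: the costs of the voters, the matrix of the assignment problem,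
the prices and the owners of its columns. The arrays 0 and 1 hold the input and the output. -/
local notation "arrCost" => 2
local notation "arrMat" => 3
local notation "arrPrice" => 4
local notation "arrOwn" => 5
/- The scalar variables used by the programs; the first eight do not change any more once the
assignment problems are being solved. -/
local notation "vAlts" => 10
local notation "vVoters" => 11
local notation "vCand" => 12
local notation "vInf" => 13
local notation "vCols" => 14
local notation "vSlots" => 15
local notation "vPhases" => 16
local notation "vScale" => 17
local notation "vBar" => 18
local notation "vRow" => 19
local notation "vCol" => 20
local notation "vPhase" => 21
local notation "vPow" => 22
local notation "vBest" => 23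
local notation "vCur" => 24
local notation "vTmp" => 25
local notation "vTotal" => 26
local notation "vIdx" => 27
local notation "vPlace" => 28

namespace Auction

open RAM Finset

/-- The entry of the matrix in row `r` and column `q`. -/
def entryExpr (r q : Expr) : Expr := .get arrMat (.add (.mul r (.var vCols)) q)

/-- What the column `q` costs the row `vCur` in the current phase: the scaled matrix entry plus the
price of the column. -/
def offerExpr (q : Expr) : Expr :=
  .add (.div (.mul (entryExpr (.sub (.var vCur) (.lit 1)) q) (.add (.var vCols) (.lit 1)))
    (.var vPow)) (.get arrPrice q)

/-- Find the cheapest column for the row `vCur`. Subtraction is truncated, so that a difference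
serves as a test for `>`. -/
def findBest : Program :=
  .seq (.set vBest (.lit 0)) (.forLoop vCol vCols
    (.cond (.sub (offerExpr (.var vBest)) (offerExpr (.var vCol)))
      (.set vBest (.var vCol)) .skip))

/-- The row `vCur` bids for its cheapest column, raising the price by `1`, and is replaced in `vCur`
by the previous owner, or by `0` if there was none. -/
def bid : Program :=
  .seq findBest
    (.seq (.assign arrPrice (.var vBest) (.add (.get arrPrice (.var vBest)) (.lit 1)))
    (.seq (.set vTmp (.get arrOwn (.var vBest)))
    (.seq (.assign arrOwn (.var vBest) (.var vCur))
    (.set vCur (.var vTmp)))))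

/-- The row `vRow` enters, and rows bid until all of them hold a column. -/
def enterRow : Program :=
  .seq (.set vCur (.add (.var vRow) (.lit 1))) (.loop (.var vCur) bid)

/-- One phase: the entries are taken with one more binary digit, the prices are doubled, and all
rows enter anew. -/
def phase : Program :=
  .seq (.set vPow (.div (.var vPow) (.lit 2)))
    (.seq (.forLoop vCol vCols
      (.seq (.assign arrPrice (.var vCol)
        (.add (.get arrPrice (.var vCol)) (.get arrPrice (.var vCol))))
      (.assign arrOwn (.var vCol) (.lit 0))))
    (.forLoop vRow vCols enterRow))

/-- Compute in `vTotal` the minimum cost of an assignment for the matrix in `arrMat`. -/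
def solve : Program :=
  .seq (.forLoop vCol vCols (.assign arrPrice (.var vCol) (.lit 0)))
    (.seq (.set vPow (.var vScale))
    (.seq (.forLoop vPhase vPhases phase)
    (.seq (.set vTotal (.lit 0))
    (.forLoop vCol vCols (.set vTotal (.add (.var vTotal)
      (entryExpr (.sub (.get arrOwn (.var vCol)) (.lit 1)) (.var vCol))))))))

/-- The memory contains the `N × N` matrix `W`, row by row. -/
structure HasMatrix (s : Memory) (N : ℕ) (W : ℕ → ℕ → ℕ) : Prop where
  cols : s vCols 0 = N
  entry : ∀ r < N, ∀ q < N, s arrMat (r * N + q) = W r q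

theorem HasMatrix.congr {s s' : Memory} {N : ℕ} {W : ℕ → ℕ → ℕ} (h : HasMatrix s N W)
    (h1 : s' vCols = s vCols) (h2 : s' arrMat = s arrMat) : HasMatrix s' N W :=
  ⟨by rw [h1, h.cols], by rw [h2]; exact h.entry⟩

/-- The matrix entries, made multiples of `N + 1` and without the binary digits beyond the
current phase. -/
def scaled (N : ℕ) (W : ℕ → ℕ → ℕ) (P : ℕ) (r q : ℕ) : ℕ := W r q * (N + 1) / P

variable {s : Memory} {N M P : ℕ} {W : ℕ → ℕ → ℕ}

theorem eval_offerExpr (h : HasMatrix s N W) (hP : s vPow 0 = P) {q : Expr} {j : ℕ}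
    (hq : q.eval s = j) (hj : j < N) (hr : s vCur 0 - 1 < N) :
    (offerExpr q).eval s = scaled N W P (s vCur 0 - 1) j + s arrPrice j := by
  simp [offerExpr, entryExpr, Expr.eval, hq, h.cols, h.entry _ hr j hj, scaled, hP]

theorem findBest_runs (h : HasMatrix s N W) (hP : s vPow 0 = P) (hM : N ≤ M)
    (hr : s vCur 0 - 1 < N) :
    Runs findBest s (M * 5 + 5) fun s' => s' vBest 0 < N ∧ ∀ k < N,
      scaled N W P (s vCur 0 - 1) (s' vBest 0) + s arrPrice (s' vBest 0) ≤
        scaled N W P (s vCur 0 - 1) k + s arrPrice k := by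
  refine Runs.assign_seq (k := M * (2 + 3) + 3) (Runs.forLoop N M (fun i s' => s' vBest 0 < N ∧
      ∀ k < i,
      scaled N W P (s vCur 0 - 1) (s' vBest 0) + s arrPrice (s' vBest 0) ≤
        scaled N W P (s vCur 0 - 1) k + s arrPrice k)
    ?_ hM (by decide) (by decide) (by decide) ?_ ?_ ?_)
  · simp [Memory.write_of_ne, h.cols]
  · simp [Memory.write_of_ne, Memory.write_self, Expr.eval]; omega
  · rintro i s' hi hcol hf ⟨hI1, hI2⟩
    have f1 := hf vCols (by decide) (by decide)
    have f2 := hf arrMat (by decide) (by decide)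
    have f3 := hf vPow (by decide) (by decide)
    have f4 := hf vCur (by decide) (by decide)
    have f5 := hf arrPrice (by decide) (by decide)
    simp only [ne_eq, Nat.reduceEqDiff, not_false_eq_true, Memory.write_of_ne] at f1 f2 f3 f4 f5
    have hm := h.congr f1 f2
    have e1 := eval_offerExpr (q := .var vBest) hm (by rw [f3, hP]) rfl hI1 (by rwa [f4])
    have e2 := eval_offerExpr (q := .var vCol) hm (by rw [f3, hP]) hcol hi (by rwa [f4])
    rw [f4, f5] at e1 e2
    simp only [Expr.eval] at e1
    refine Runs.cond ?_ ?_
    · intro hne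
      simp only [Expr.eval, e1, e2] at hne
      refine Runs.assign ?_
      simp only [Expr.eval, Memory.write_of_ne, Memory.write_self, ne_eq, Nat.reduceEqDiff,
        not_false_eq_true, Function.update_self, hcol]
      refine ⟨hi, fun k hk => ?_⟩
      rcases Nat.lt_succ_iff_lt_or_eq.1 hk with hk | rfl
      · have := hI2 k hk; omega
      · exact le_rfl
    · intro hne
      simp only [Expr.eval, e1, e2] at hne
      refine Runs.skip ?_
      simp only [Memory.write_of_ne, ne_eq, Nat.reduceEqDiff, not_false_eq_true]
      refine ⟨hI1, fun k hk => ?_⟩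
      rcases Nat.lt_succ_iff_lt_or_eq.1 hk with hk | rfl
      · exact hI2 k hk
      · omega
  · rintro s' - hI
    exact hI

/-- Bids are made until no row is left without a column. -/
theorem bids_runs (h : HasMatrix s N W) (hP : s vPow 0 = P) (hM : N ≤ M) {v₀ π : ℕ → ℕ} {r : ℕ}
    (hr : r ≤ N) (hπ : IsAssignment N π) (hC : NearlyCheapest N (scaled N W P) v₀ π 3)
    (hS : State N (scaled N W P) v₀ (s arrPrice) (s arrOwn) r (s vCur 0)) :
    Runs (.loop (.var vCur) bid) s (M * (4 * M + 4) * (M * 5 + 14) + 1) fun s' =>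
      State N (scaled N W P) v₀ (s' arrPrice) (s' arrOwn) r 0 := by
  refine Runs.loop (k := M * 5 + 13)
    (fun s' => State N (scaled N W P) v₀ (s' arrPrice) (s' arrOwn) r (s' vCur 0))
    (fun s' => potential N v₀ (s' arrPrice)) (M * (4 * M + 4)) ?_ ?_ hS ?_
  · intro s' hf hS' hne
    simp only [Expr.eval] at hne
    have hm := h.congr (hf vCols (by decide)) (hf arrMat (by decide))
    have hP' : s' vPow 0 = P := by rw [hf vPow (by decide), hP]
    have hc : s' vCur 0 - 1 < N := by have := hS'.cur_le; omega
    refine Runs.seq (k := M * 5 + 5) (k' := 7) ((findBest_runs hm hP' hM hc).mono le_rfl ?_)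
    rintro s'' hf' ⟨hb, hmin⟩
    refine Runs.assign_seq (k := 5) (Runs.assign_seq (k := 3) (Runs.assign_seq (k := 1)
      (Runs.assign ?_)))
    have g1 := hf' vCur (by decide)
    have g2 := hf' arrPrice (by decide)
    have g3 := hf' arrOwn (by decide)
    simp only [Expr.eval, Memory.write_of_ne, Memory.write_self, ne_eq, Nat.reduceEqDiff,
        not_false_eq_true, Function.update_self, g1, g2, g3]
    exact ⟨hS'.bid hne hb hmin,
      potential_update_lt hb (hS'.bid_price_le hr hne hπ hC hb hmin)⟩
  · intro s' _ hS' he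
    simp only [Expr.eval] at he
    rwa [he] at hS'
  · exact hS.potential_le.trans (by gcongr)

/-- A bound on the number of instructions of a phase, for at most `M` columns. -/
def phaseBound (M : ℕ) : ℕ :=
  M * (M * (4 * M + 4) * (M * 5 + 14) + 6) + (M * 6 + 9)

theorem phase_runs (h : HasMatrix s N W) (hP : s vPow 0 = 2 * P) (hM : N ≤ M)
    {π : ℕ → ℕ} (hπ : IsAssignment N π)
    (hC : NearlyCheapest N (scaled N W (2 * P)) (s arrPrice) π 1) :
    Runs phase s (phaseBound M) fun s' => s' vPow 0 = P ∧
      ∃ π, IsAssignment N π ∧ NearlyCheapest N (scaled N W P) (s' arrPrice) π 1 ∧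
      (∀ j < N, s' arrOwn j - 1 < N) ∧
      ∀ f : ℕ → ℕ → ℕ, ∑ j ∈ range N, f (s' arrOwn j - 1) j = ∑ r ∈ range N, f r (π r) := by
  have hC' : NearlyCheapest N (scaled N W P) (fun j => s arrPrice j + s arrPrice j) π 3 := by
    refine hC.double (fun r _ k _ => ?_) hπ
    have : scaled N W (2 * P) r k = scaled N W P r k / 2 := by
      simp only [scaled]
      rw [mul_comm 2 P, Nat.div_div_eq_div_mul]
    omega
  set v₀ : ℕ → ℕ := fun j => s arrPrice j + s arrPrice j with hv₀
  unfold phase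
  refine Runs.mono (k := (M * (3 + 3) + 3) + (M * (M * (4 * M + 4) * (M * 5 + 14) + 6) + 3)
    + 1 + 2) ?_ (by unfold phaseBound; omega) fun _ _ h => h
  refine Runs.assign_seq (Runs.seq ?_)
  refine Runs.forLoop N M (fun i s' =>
      (∀ j < i, s' arrPrice j = v₀ j ∧ s' arrOwn j = 0) ∧
        ∀ j, i ≤ j → s' arrPrice j = s arrPrice j)
    ?_ hM (by decide) (by decide) (by decide) ?_ ?_ ?_
  · simp [Memory.write_of_ne, h.cols]
  · refine ⟨fun j hj => absurd hj (by omega), fun j _ => ?_⟩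
    simp [Memory.write_of_ne]
  · rintro i s' hi hcol - ⟨hI1, hI2⟩
    refine Runs.assign_seq (k := 1) (Runs.assign ?_)
    simp only [Expr.eval, Memory.write_of_ne, Memory.write_self, ne_eq, Nat.reduceEqDiff,
        not_false_eq_true, hcol]
    refine ⟨fun j hj => ?_, fun j hj => ?_⟩
    · rcases Nat.lt_succ_iff_lt_or_eq.1 hj with hj' | rfl
      · rw [Function.update_of_ne (by omega), Function.update_of_ne (by omega)]
        exact hI1 j hj'
      · simp [hI2 j le_rfl, hv₀]
    · rw [Function.update_of_ne (by omega)]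
      exact hI2 j (by omega)
  rintro s₁ hf ⟨hI, -⟩
  have f1 : s₁ vCols = s vCols := by
    rw [hf vCols (by decide) (by decide)]; simp [Memory.write_of_ne]
  have f2 : s₁ arrMat = s arrMat := by
    rw [hf arrMat (by decide) (by decide)]; simp [Memory.write_of_ne]
  have f3 : s₁ vPow 0 = P := by
    rw [hf vPow (by decide) (by decide)]
    simp [Memory.write_self, Expr.eval, hP]
  have hm := h.congr f1 f2
  refine Runs.forLoop N M
    (fun i s' => State N (scaled N W P) v₀ (s' arrPrice) (s' arrOwn) i 0)
    hm.cols hM (by decide) (by decide) (by decide) ?_ ?_ ?_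
  · simp only [Memory.write_of_ne, ne_eq, Nat.reduceEqDiff, not_false_eq_true]
    exact State.init (fun j hj => (hI j hj).1) fun j hj => (hI j hj).2
  · intro i s' hi hrow hf' hS
    have g1 := hf' vCols (by decide) (by decide)
    have g2 := hf' arrMat (by decide) (by decide)
    have g3 := hf' vPow (by decide) (by decide)
    refine Runs.assign_seq (k := M * (4 * M + 4) * (M * 5 + 14) + 1)
      ((bids_runs (N := N) (W := W) (P := P) (v₀ := v₀) (π := π) (r := i + 1)
        ?_ ?_ hM hi hπ hC' ?_).mono le_rfl ?_)
    · exact hm.congr (by simp [Memory.write_of_ne, g1]) (by simp [Memory.write_of_ne, g2])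
    · simp [Memory.write_of_ne, g3, f3]
    · simp only [Expr.eval, Memory.write_of_ne, Memory.write_self, ne_eq, Nat.reduceEqDiff,
        not_false_eq_true, hrow, Function.update_self]
      exact hS.enter
    · intro s'' _ hS'
      simpa [Memory.write_of_ne] using hS'
  · intro s' hf' hS
    refine ⟨?_, hS.finish⟩
    rw [hf' vPow (by decide) (by decide), f3]

/-- A bound on the number of instructions for solving an assignment problem with at most `M` columns
in at most `M` phases. -/
def solveBound (M : ℕ) : ℕ := M * (phaseBound M + 3) + (M * 8 + 15)

theorem solve_runs {T : ℕ} (h : HasMatrix s N W) (hT : s vPhases 0 = T) (hT0 : T ≠ 0)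
    (hP : s vScale 0 = 2 ^ T) (hW : ∀ r < N, ∀ q < N, W r q * (N + 1) < 2 ^ T)
    (hM : N ≤ M) (hTM : T ≤ M) :
    Runs solve s (solveBound M) fun s' =>
      (∃ π, IsAssignment N π ∧ s' vTotal 0 = ∑ r ∈ range N, W r (π r)) ∧
      ∀ σ, IsAssignment N σ → s' vTotal 0 ≤ ∑ r ∈ range N, W r (σ r) := by
  unfold solve
  refine Runs.mono (k := (M * (1 + 3) + 3) + ((M * (phaseBound M + 3) + 3) +
    (M * (1 + 3) + 3 + 2) + 1 + 2) + 1) ?_ (by unfold solveBound; omega) fun _ _ h => h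
  refine Runs.seq (Runs.forLoop N M (fun i s' => ∀ j < i, s' arrPrice j = 0)
    h.cols hM (by decide) (by decide) (by decide) (fun j hj => absurd hj (by omega)) ?_ ?_)
  · intro i s' hi hcol _ hI
    refine Runs.assign ?_
    simp only [Expr.eval, Memory.write_of_ne, Memory.write_self, ne_eq, Nat.reduceEqDiff,
        not_false_eq_true, hcol]
    intro j hj
    rcases Nat.lt_succ_iff_lt_or_eq.1 hj with hj' | rfl
    · rw [Function.update_of_ne (by omega)]
      exact hI j hj'
    · simp
  intro s₁ hf hprice
  have hm : HasMatrix s₁ N W :=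
    h.congr (hf vCols (by decide) (by decide)) (hf arrMat (by decide) (by decide))
  have f1 : s₁ vPhases 0 = T := by rw [hf vPhases (by decide) (by decide), hT]
  have f2 : s₁ vScale 0 = 2 ^ T := by rw [hf vScale (by decide) (by decide), hP]
  refine Runs.assign_seq (Runs.seq (Runs.forLoop T M (fun i s' => s' vPow 0 = 2 ^ (T - i) ∧
      ∃ π, IsAssignment N π ∧ NearlyCheapest N (scaled N W (2 ^ (T - i))) (s' arrPrice) π 1 ∧
      (i ≠ 0 → (∀ j < N, s' arrOwn j - 1 < N) ∧ ∀ f : ℕ → ℕ → ℕ,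
        ∑ j ∈ range N, f (s' arrOwn j - 1) j = ∑ r ∈ range N, f r (π r)))
    ?_ hTM (by decide) (by decide) (by decide) ?_ ?_ ?_))
  · simpa [Memory.write_of_ne] using f1
  · -- Initially all scaled entries and all prices are zero, so every assignment is cheapest.
    simp only [Expr.eval, Memory.write_of_ne, Memory.write_self, ne_eq, Nat.reduceEqDiff,
      not_false_eq_true, f2, Function.update_self, tsub_zero, true_and, not_true_eq_false,
      false_implies, and_true]
    refine ⟨id, ⟨fun _ h => h, fun _ _ _ _ h => h⟩, fun r hr k hk => ?_⟩
    have h0 : scaled N W (2 ^ T) r r = 0 := Nat.div_eq_of_lt (hW r hr r hr)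
    simp [h0, hprice r hr]
  · rintro i s' hi - hf' ⟨hI1, π, hπ, hC, -⟩
    have g1 := hf' vCols (by decide) (by decide)
    have g2 := hf' arrMat (by decide) (by decide)
    have hpow : 2 ^ (T - i) = 2 * 2 ^ (T - (i + 1)) := by
      rw [← pow_succ']; congr 1; omega
    rw [hpow] at hI1 hC
    have hm' : HasMatrix s' N W := hm.congr (by rw [g1]; simp [Memory.write_of_ne])
      (by rw [g2]; simp [Memory.write_of_ne])
    refine (phase_runs hm' hI1 hM hπ hC).mono le_rfl ?_
    rintro s'' - ⟨h1, π', h2, h3, h4⟩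
    simp only [Memory.write_of_ne, ne_eq, Nat.reduceEqDiff, not_false_eq_true]
    exact ⟨h1, π', h2, h3, fun _ => h4⟩
  rintro s₂ hf₂ ⟨-, π, hπ, hC, hown⟩
  have hm₂ : HasMatrix s₂ N W :=
    hm.congr (by rw [hf₂ vCols (by decide) (by decide)]; simp [Memory.write_of_ne])
      (by rw [hf₂ arrMat (by decide) (by decide)]; simp [Memory.write_of_ne])
  obtain ⟨hown, hsum⟩ := hown hT0
  have hcheap : NearlyCheapest N (fun r k => W r k * (N + 1)) (s₂ arrPrice) π 1 := by
    simpa [scaled, NearlyCheapest] using hC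
  refine Runs.assign_seq (Runs.forLoop N M (fun i s' =>
      s' vTotal 0 = ∑ j ∈ range i, W (s₂ arrOwn j - 1) j)
    ?_ hM (by decide) (by decide) (by decide) ?_ ?_ ?_)
  · simpa [Memory.write_of_ne] using hm₂.cols
  · simp [Expr.eval, Memory.write_of_ne, Memory.write_self]
  · intro i s' hi hcol hf' hI
    have g1 : s' vCols 0 = N := by
      rw [hf' vCols (by decide) (by decide)]; simpa [Memory.write_of_ne] using hm₂.cols
    have g2 : s' arrMat = s₂ arrMat := by
      rw [hf' arrMat (by decide) (by decide)]; simp [Memory.write_of_ne]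
    have g3 : s' arrOwn = s₂ arrOwn := by
      rw [hf' arrOwn (by decide) (by decide)]; simp [Memory.write_of_ne]
    refine Runs.assign ?_
    simp only [entryExpr, Expr.eval, Memory.write_of_ne, Memory.write_self, ne_eq,
      Nat.reduceEqDiff, not_false_eq_true, hcol, Function.update_self, g1, g2, g3, hI,
      sum_range_succ]
    rw [hm₂.entry _ (hown i hi) i hi]
  · rintro s' - hI
    rw [hsum W] at hI
    exact ⟨⟨π, hπ, hI⟩, fun σ hσ => hI ▸ hcheap.sum_le hπ hσ⟩

end Auction

/-! ### The bribery problem as a program -/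

namespace Bribery

open RAM Auction Finset

/-- The price of moving the alternative at place `k` of a voter to the first place, or for veto to
the last one, when `κ` times the number of places it moves may be at most `δ`: nothing if it is
there already, and `inf` if the move is not allowed. A price `p` above `inf`, which is beyond the
budget, is cut down to `inf`, so that all costs are bounded by `inf`. -/
def placeCost (veto : Bool) (κ m inf δ p k : ℕ) : ℕ :=
  let d := if veto then m - 1 - k else k
  if d = 0 then 0 else if κ * d ≤ δ then min p inf else inf

/-- The alternatives that are to receive more top places than the bar `K`, for plurality, or more
last places, for veto. The other alternatives are to receive at most `K`. -/
def Above (veto : Bool) (c b : ℕ) : Prop := if veto then b ≠ c else b = c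

instance (veto : Bool) (c b : ℕ) : Decidable (Above veto c b) := by
  unfold Above; infer_instance

/-- The assignment problem of voters and dummies to slots, `S` for each alternative. The first `n`
rows are the voters, who pay `cost`; the other rows are dummies. A voter in the slot `k` of the
alternative `b` stands for a top (or last) place given to `b`, a dummy for an empty slot.
Forbidden pairs have the entry `inf`. -/
def barMatrix (veto : Bool) (n S c inf K : ℕ) (cost : ℕ → ℕ → ℕ) (r q : ℕ) : ℕ :=
  if r < n then
    if ¬ Above veto c (q / S) ∧ K ≤ q % S then inf else cost r (q / S)
  else
    if Above veto c (q / S) ∧ q % S ≤ K then inf else 0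

/-- The input cell where the data of the voter `vIdx` begin. -/
def voterExpr : Expr := .add (.lit 4) (.mul (.var vIdx) (.add (.var vAlts) (.lit 2)))

/-- The number of places that the alternative at place `vPlace` has to move. -/
def distExpr (veto : Bool) : Expr :=
  if veto then .sub (.sub (.var vAlts) (.lit 1)) (.var vPlace) else .var vPlace

/-- Write the cost of the alternative at place `vPlace` of the voter `vIdx`. -/
def setCost (e : Expr) : Program :=
  .assign arrCost (.add (.mul (.var vIdx) (.var vAlts))
    (.get 0 (.add voterExpr (.add (.lit 2) (.var vPlace))))) e

/-- Read the parameters of the instance and count the slots. -/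
def readSizes : Program :=
  .seq (.set vAlts (.get 0 (.lit 0)))
    (.seq (.set vVoters (.get 0 (.lit 1)))
    (.seq (.set vCand (.get 0 (.lit 2)))
    (.seq (.set vInf (.add (.get 0 (.lit 3)) (.lit 1)))
    (.seq (.set vSlots (.add (.var vVoters) (.lit 1)))
    (.seq (.set vCols (.lit 0))
    (.forLoop vIdx vAlts (.set vCols (.add (.var vCols) (.var vSlots)))))))))

/-- Compute the costs of the voters. With truncated subtraction `p - (p - inf)` is the minimum of
`p` and `inf`. -/
def readCosts (veto : Bool) (κ : ℕ) : Program :=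
  .forLoop vIdx vVoters (.forLoop vPlace vAlts
    (.cond (distExpr veto)
      (.cond (.sub (.mul (.lit κ) (distExpr veto)) (.get 0 voterExpr))
        (setCost (.var vInf))
        (setCost (.sub (.get 0 (.add voterExpr (.lit 1)))
          (.sub (.get 0 (.add voterExpr (.lit 1))) (.var vInf)))))
      (setCost (.lit 0))))

/-- Find a power of two exceeding all scaled matrix entries. -/
def findScale : Program :=
  .seq (.set vPhases (.lit 0))
    (.seq (.set vScale (.lit 1))
    (.loop (.sub (.add (.mul (.add (.var vCols) (.lit 1)) (.var vInf)) (.lit 1)) (.var vScale))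
      (.seq (.set vScale (.add (.var vScale) (.var vScale)))
      (.set vPhases (.add (.var vPhases) (.lit 1))))))

/-- The alternative to which the slot `vCol` belongs. -/
def altExpr : Expr := .div (.var vCol) (.var vSlots)

/-- The number of the slot `vCol` among those of its alternative, a remainder modulo `vSlots`. -/
def slotExpr : Expr := .sub (.var vCol) (.mul altExpr (.var vSlots))

/-- Test whether the alternative of the slot `vCol` is to be above the bar. -/
def aboveExpr (veto : Bool) : Expr :=
  if veto then .add (.sub altExpr (.var vCand)) (.sub (.var vCand) altExpr)
  else .sub (.lit 1) (.add (.sub altExpr (.var vCand)) (.sub (.var vCand) altExpr))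

/-- Write the matrix entry in row `vRow` and column `vCol`. -/
def setEntry (e : Expr) : Program :=
  .assign arrMat (.add (.mul (.var vRow) (.var vCols)) (.var vCol)) e

/-- The cost of the voter `vRow` for the alternative of the slot `vCol`. -/
def costExpr : Expr := .get arrCost (.add (.mul (.var vRow) (.var vAlts)) altExpr)

/-- Compute the matrix `barMatrix` for the bar `vBar`. -/
def buildMatrix (veto : Bool) : Program :=
  .forLoop vRow vCols (.forLoop vCol vCols
    (.cond (.sub (.var vVoters) (.var vRow))
      (.cond (aboveExpr veto)
        (setEntry costExpr)
        (.cond (.sub (.add slotExpr (.lit 1)) (.var vBar))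
          (setEntry (.var vInf))
          (setEntry costExpr)))
      (.cond (aboveExpr veto)
        (.cond (.sub (.add (.var vBar) (.lit 1)) slotExpr)
          (setEntry (.var vInf))
          (setEntry (.lit 0)))
        (setEntry (.lit 0)))))

/-- Solve the assignment problem of every bar and write `1` into the output cell if the minimum cost
is less than `vInf`, which is the budget plus one. -/
def tryBars (veto : Bool) : Program :=
  .forLoop vBar vSlots
    (.seq (buildMatrix veto)
    (.seq solve
    (.cond (.sub (.var vInf) (.var vTotal)) (.set 1 (.lit 1)) .skip)))

/-- Decide the bribery problem for plurality or veto; the distance enters through the factor `κ`. -/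
def decideBribery (veto : Bool) (κ : ℕ) : Program :=
  .seq readSizes (.seq (readCosts veto κ) (.seq findScale (tryBars veto)))

/-- The memory contains an instance with the given data in the input array; `alt i k` is the
alternative at place `k` of the voter `i`, and `pos i` the inverse of `alt i`. -/
structure HasInput (s : Memory) (m n c B : ℕ) (δ p : ℕ → ℕ) (alt pos : ℕ → ℕ → ℕ) : Prop where
  alts : s 0 0 = m
  voters : s 0 1 = n
  cand : s 0 2 = c
  budget : s 0 3 = B
  bound : ∀ i < n, s 0 (4 + i * (m + 2)) = δ i
  price : ∀ i < n, s 0 (4 + i * (m + 2) + 1) = p i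
  place : ∀ i < n, ∀ k < m, s 0 (4 + i * (m + 2) + (2 + k)) = alt i k
  alt_lt : ∀ i < n, ∀ k < m, alt i k < m
  pos_lt : ∀ i < n, ∀ b < m, pos i b < m
  alt_pos : ∀ i < n, ∀ b < m, alt i (pos i b) = b
  pos_alt : ∀ i < n, ∀ k < m, pos i (alt i k) = k

/-- The parameters of the instance have been read. -/
structure HasSizes (s : Memory) (m n c inf : ℕ) : Prop where
  alts : s vAlts 0 = m
  voters : s vVoters 0 = n
  cand : s vCand 0 = c
  inf : s vInf 0 = inf
  slots : s vSlots 0 = n + 1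
  cols : s vCols 0 = m * (n + 1)

theorem HasSizes.congr {s s' : Memory} {m n c inf : ℕ} (h : HasSizes s m n c inf)
    (hf : ∀ a ∈ [vAlts, vVoters, vCand, vInf, vSlots, vCols], s' a = s a) :
    HasSizes s' m n c inf := by
  obtain ⟨h1, h2, h3, h4, h5, h6⟩ := h
  constructor
  all_goals rw [hf _ (by decide)]; assumption

theorem row_index_inj {m i j a b : ℕ} (ha : a < m) (hb : b < m) (h : i * m + a = j * m + b) :
    i = j ∧ a = b := by
  have hm : 0 < m := by omega
  have h1 : (i * m + a) / m = i := by
    rw [mul_comm, Nat.mul_add_div hm, Nat.div_eq_of_lt ha, add_zero]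
  have h2 : (j * m + b) / m = j := by
    rw [mul_comm, Nat.mul_add_div hm, Nat.div_eq_of_lt hb, add_zero]
  rw [h, h2] at h1
  subst h1
  omega

variable {s : Memory} {m n c B M inf κ : ℕ} {δ p : ℕ → ℕ} {alt pos : ℕ → ℕ → ℕ} {veto : Bool}

theorem readSizes_runs (h : HasInput s m n c B δ p alt pos) (hM : m ≤ M) :
    Runs readSizes s (M * 4 + 15) fun s' => HasSizes s' m n c (B + 1) := by
  refine Runs.assign_seq (k := M * 4 + 13) (Runs.assign_seq (k := M * 4 + 11)
    (Runs.assign_seq (k := M * 4 + 9) (Runs.assign_seq (k := M * 4 + 7)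
    (Runs.assign_seq (k := M * 4 + 5) (Runs.assign_seq (k := M * (1 + 3) + 3)
    (Runs.forLoop m M (fun i s' => s' vCols 0 = i * (n + 1))
      ?_ hM (by decide) (by decide) (by decide) ?_ ?_ ?_))))))
  · simp [Expr.eval, Memory.write_of_ne, Memory.write_self, h.alts]
  · simp [Expr.eval, Memory.write_of_ne, Memory.write_self]
  · intro i s' hi hidx hf hI
    have f1 := hf vSlots (by decide) (by decide)
    refine Runs.assign ?_
    simp only [Expr.eval, f1, Memory.write_of_ne, Memory.write_self, ne_eq, Nat.reduceEqDiff,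
      not_false_eq_true, Function.update_self, hI, h.voters, OfNat.zero_ne_ofNat]
    ring
  · intro s' hf hI
    have f1 := hf vAlts (by decide) (by decide)
    have f2 := hf vVoters (by decide) (by decide)
    have f3 := hf vCand (by decide) (by decide)
    have f4 := hf vInf (by decide) (by decide)
    have f5 := hf vSlots (by decide) (by decide)
    simp only [Expr.eval, Memory.write_of_ne, Memory.write_self, ne_eq, Nat.reduceEqDiff,
      not_false_eq_true, OfNat.zero_ne_ofNat] at f1 f2 f3 f4 f5
    constructor
    · simp [f1, h.alts]
    · simp [f2, h.voters]
    · simp [f3, h.cand]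
    · simp [f4, h.budget]
    · simp [f5, h.voters]
    · exact hI

theorem readCosts_runs (h : HasInput s m n c B δ p alt pos) (hs : HasSizes s m n c inf)
    (hm : m ≤ M) (hn : n ≤ M) :
    Runs (readCosts veto κ) s (M * (M * 6 + 6) + 3) fun s' => ∀ i < n, ∀ b < m,
      s' arrCost (i * m + b) = placeCost veto κ m inf (δ i) (p i) (pos i b) := by
  suffices H : Runs (readCosts veto κ) s (M * (M * 6 + 6) + 3) fun s' => ∀ i < n, ∀ k < m,
      s' arrCost (i * m + alt i k) = placeCost veto κ m inf (δ i) (p i) k by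
    refine H.mono le_rfl fun s' _ hs' i hi b hb => ?_
    have := hs' i hi (pos i b) (h.pos_lt i hi b hb)
    rwa [h.alt_pos i hi b hb] at this
  refine Runs.mono (k := M * ((M * (3 + 3) + 3) + 3) + 3) (Runs.forLoop n M (fun i s' =>
      ∀ i' < i, ∀ k < m, s' arrCost (i' * m + alt i' k) =
        placeCost veto κ m inf (δ i') (p i') k)
    hs.voters hn ?_ ?_ (by decide) (fun _ h => absurd h (by omega)) ?_ fun _ _ h => h)
    (le_of_eq (by ring)) fun _ _ h => h
  · simp [Program.mods, Program.forLoop, setCost]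
  · simp [Program.mods, Program.forLoop, setCost]
  intro i s₁ hi hidx hf₁ hI₁
  have frame₁ : ∀ a, a ≠ vIdx → a ≠ vPlace → a ≠ arrCost → s₁ a = s a := fun a h1 h2 h3 =>
    hf₁ a h1 (by simp [Program.mods, Program.forLoop, setCost, h2, h3])
  refine Runs.forLoop m M (fun k s' => (∀ i' < i, ∀ k < m, s' arrCost (i' * m + alt i' k) =
        placeCost veto κ m inf (δ i') (p i') k) ∧
      ∀ k' < k, s' arrCost (i * m + alt i k') = placeCost veto κ m inf (δ i) (p i) k')
    (by rw [frame₁ vAlts (by decide) (by decide) (by decide), hs.alts]) hm ?_ ?_ (by decide)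
    ⟨?_, fun _ h => absurd h (by omega)⟩ ?_ ?_
  · simp [Program.mods, setCost]
  · simp [Program.mods, setCost]
  · simpa [Memory.write_of_ne] using hI₁
  · rintro k s₂ hk hplace hf₂ ⟨hI₂, hI₃⟩
    have frame₂ : ∀ a, a ≠ vPlace → a ≠ arrCost → s₂ a = s₁ a := fun a h1 h2 =>
      hf₂ a h1 (by simp [Program.mods, setCost, h2])
    have frame : ∀ a, a ≠ vIdx → a ≠ vPlace → a ≠ arrCost → s₂ a = s a := fun a h1 h2 h3 =>
      (frame₂ a h2 h3).trans (frame₁ a h1 h2 h3)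
    have g1 : s₂ vIdx 0 = i := by rw [frame₂ vIdx (by decide) (by decide), hidx]
    have g2 : s₂ vAlts 0 = m := by
      rw [frame vAlts (by decide) (by decide) (by decide), hs.alts]
    have g3 : s₂ vInf 0 = inf := by
      rw [frame vInf (by decide) (by decide) (by decide), hs.inf]
    have g4 : s₂ 0 = s 0 := frame 0 (by decide) (by decide) (by decide)
    have hd : (distExpr veto).eval s₂ = if veto then m - 1 - k else k := by
      cases veto <;> simp [distExpr, Expr.eval, g2, hplace]
    have set : ∀ e : Expr, e.eval s₂ = placeCost veto κ m inf (δ i) (p i) k →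
        Runs (setCost e) s₂ 1 fun s' => (∀ i' < i, ∀ k < m,
          (s'.write vPlace 0 (k + 1)) arrCost (i' * m + alt i' k) =
            placeCost veto κ m inf (δ i') (p i') k) ∧
          ∀ k' < k + 1, (s'.write vPlace 0 (k + 1)) arrCost (i * m + alt i k') =
            placeCost veto κ m inf (δ i) (p i) k' := by
      intro e he
      refine Runs.assign ?_
      simp only [voterExpr, Expr.eval, Memory.write_of_ne, Memory.write_self, ne_eq,
        Nat.reduceEqDiff, not_false_eq_true, g1, g2, g4, hplace, h.place i hi k hk, he]
      have hak := h.alt_lt i hi k hk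
      -- Different places of a voter hold different alternatives, so no earlier cell is overwritten.
      refine ⟨fun i' hi' k' hk' => ?_, fun k' hk' => ?_⟩
      · rw [Function.update_of_ne]
        · exact hI₂ i' hi' k' hk'
        · intro he
          have := (row_index_inj (h.alt_lt i' (by omega) k' hk') hak he).1
          omega
      · rcases Nat.lt_succ_iff_lt_or_eq.1 hk' with hk' | rfl
        · rw [Function.update_of_ne]
          · exact hI₃ k' hk'
          · intro he
            have h1 := (row_index_inj (h.alt_lt i hi k' (by omega)) hak he).2
            have h2 := h.pos_alt i hi k' (by omega)
            rw [h1, h.pos_alt i hi k hk] at h2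
            omega
        · simp
    refine Runs.cond (k := 2) (fun h1 => Runs.cond (k := 1) (fun h2 => ?_) fun h2 => ?_)
      fun h1 => (?_ : Runs _ _ 1 _).mono (by omega) fun _ _ h => h
    all_goals simp only [hd] at h1
    all_goals try simp only [Expr.eval, hd, voterExpr, g1, g2, g4, h.bound i hi] at h2
    all_goals refine (set _ ?_).mono le_rfl fun _ _ h => h
    all_goals simp only [Expr.eval, voterExpr, g1, g2, g3, g4, h.price i hi, placeCost]
    · rw [if_neg h1, if_neg (by omega)]
    · rw [if_neg h1, if_pos (by omega)]; omega
    · rw [if_pos h1]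
  · rintro s₂ - ⟨hI₂, hI₃⟩
    simp only [Memory.write_of_ne, ne_eq, Nat.reduceEqDiff, not_false_eq_true]
    intro i' hi'
    rcases Nat.lt_succ_iff_lt_or_eq.1 hi' with hi' | rfl
    · exact hI₂ i' hi'
    · exact hI₃

theorem readCosts_mods (veto : Bool) (κ : ℕ) :
    (readCosts veto κ).mods = [vIdx, vPlace, arrCost, arrCost, arrCost, vPlace, vIdx] :=
  rfl

theorem findScale_runs (hs : HasSizes s m n c inf)
    (hM : Nat.size ((m * (n + 1) + 1) * inf) ≤ M) (hinf : inf ≠ 0) :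
    Runs findScale s (M * 5 + 5) fun s' => ∃ T, s' vPhases 0 = T ∧ T ≠ 0 ∧ T ≤ M ∧
      s' vScale 0 = 2 ^ T ∧ (m * (n + 1) + 1) * inf < 2 ^ T := by
  set X := (m * (n + 1) + 1) * inf with hX
  have hX0 : X ≠ 0 := by simp [hX, hinf]
  refine Runs.assign_seq (k := M * 5 + 3) (Runs.assign_seq (k := M * (4 + 1) + 1) (Runs.loop
    (fun s' => s' vScale 0 = 2 ^ s' vPhases 0 ∧ s' vPhases 0 ≤ X.size)
    (fun s' => X.size - s' vPhases 0) M ?_ ?_ ?_ ?_))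
  · rintro s' hf ⟨h1, h2⟩ hne
    have g1 := hf vCols (by decide)
    have g2 := hf vInf (by decide)
    simp only [Memory.write_of_ne, ne_eq, Nat.reduceEqDiff, not_false_eq_true] at g1 g2
    simp only [Expr.eval, g1, g2, hs.cols, hs.inf, h1, ← hX] at hne
    have hlt : s' vPhases 0 < X.size := Nat.lt_size.2 (by omega)
    refine (Runs.assign_seq (k := 1) (Runs.assign ?_)).mono (by omega) fun _ _ h => h
    simp only [Expr.eval, Memory.write_of_ne, Memory.write_self, ne_eq, Nat.reduceEqDiff,
      not_false_eq_true, Function.update_self, h1]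
    refine ⟨⟨by ring, hlt⟩, by omega⟩
  · rintro s' hf ⟨h1, h2⟩ hne
    have g1 := hf vCols (by decide)
    have g2 := hf vInf (by decide)
    simp only [Memory.write_of_ne, ne_eq, Nat.reduceEqDiff, not_false_eq_true] at g1 g2
    simp only [Expr.eval, g1, g2, hs.cols, hs.inf, h1, ← hX] at hne
    refine ⟨_, rfl, ?_, by omega, h1, by omega⟩
    intro h0
    rw [h0] at hne
    omega
  · simp [Expr.eval, Memory.write_of_ne, Memory.write_self]
  · simp [Expr.eval, Memory.write_of_ne, Memory.write_self, hM]

theorem buildMatrix_runs {K : ℕ} {cost : ℕ → ℕ → ℕ} (hs : HasSizes s m n c inf)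
    (hcost : ∀ i < n, ∀ b < m, s arrCost (i * m + b) = cost i b)
    (hK : s vBar 0 = K) (hM : m * (n + 1) ≤ M) :
    Runs (buildMatrix veto) s (M * (M * 7 + 6) + 3) fun s' =>
      HasMatrix s' (m * (n + 1)) (barMatrix veto n (n + 1) c inf K cost) := by
  set N := m * (n + 1) with hN
  set W := barMatrix veto n (n + 1) c inf K cost with hW
  refine Runs.mono (k := M * ((M * (4 + 3) + 3) + 3) + 3) (Runs.forLoop N M (fun r s' =>
      ∀ r' < r, ∀ q < N, s' arrMat (r' * N + q) = W r' q)
    hs.cols hM ?_ ?_ (by decide) (fun _ h => absurd h (by omega)) ?_ fun s' hf hI => ?_)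
    (le_of_eq (by ring)) fun _ _ h => h
  · simp [Program.mods, Program.forLoop, setEntry]
  · simp [Program.mods, Program.forLoop, setEntry]
  · intro r s₁ hr hrow hf₁ hI₁
    have frame₁ : ∀ a, a ≠ vRow → a ≠ vCol → a ≠ arrMat → s₁ a = s a := fun a h1 h2 h3 =>
      hf₁ a h1 (by simp [Program.mods, Program.forLoop, setEntry, h2, h3])
    refine Runs.forLoop N M (fun q s' => (∀ r' < r, ∀ q < N, s' arrMat (r' * N + q) = W r' q) ∧
        ∀ q' < q, s' arrMat (r * N + q') = W r q')
      (by rw [frame₁ vCols (by decide) (by decide) (by decide), hs.cols]) hM ?_ ?_ (by decide)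
      ⟨?_, fun _ h => absurd h (by omega)⟩ ?_ ?_
    · simp [Program.mods, setEntry]
    · simp [Program.mods, setEntry]
    · simpa [Memory.write_of_ne] using hI₁
    · rintro q s₂ hq hcol hf₂ ⟨hI₂, hI₃⟩
      have frame₂ : ∀ a, a ≠ vCol → a ≠ arrMat → s₂ a = s₁ a := fun a h1 h2 =>
        hf₂ a h1 (by simp [Program.mods, setEntry, h2])
      have frame : ∀ a, a ≠ vRow → a ≠ vCol → a ≠ arrMat → s₂ a = s a := fun a h1 h2 h3 =>
        (frame₂ a h2 h3).trans (frame₁ a h1 h2 h3)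
      have g1 : s₂ vRow 0 = r := by rw [frame₂ vRow (by decide) (by decide), hrow]
      have g2 : s₂ vBar 0 = K := by
        rw [frame vBar (by decide) (by decide) (by decide), hK]
      have g3 : s₂ arrCost = s arrCost := frame arrCost (by decide) (by decide) (by decide)
      have hs₂ : HasSizes s₂ m n c inf := hs.congr fun a ha => by
        simp only [List.mem_cons, List.not_mem_nil, or_false] at ha
        exact frame a (by omega) (by omega) (by omega)
      have set : ∀ e : Expr, e.eval s₂ = W r q →
          Runs (setEntry e) s₂ 1 fun s' => (∀ r' < r, ∀ q' < N,
            (s'.write vCol 0 (q + 1)) arrMat (r' * N + q') = W r' q') ∧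
            ∀ q' < q + 1, (s'.write vCol 0 (q + 1)) arrMat (r * N + q') = W r q' := by
        intro e he
        refine Runs.assign ?_
        simp only [Expr.eval, Memory.write_of_ne, Memory.write_self, ne_eq,
          Nat.reduceEqDiff, not_false_eq_true, g1, hs₂.cols, ← hN, hcol, he]
        refine ⟨fun r' hr' q' hq' => ?_, fun q' hq' => ?_⟩
        · rw [Function.update_of_ne]
          · exact hI₂ r' hr' q' hq'
          · intro he
            have := (row_index_inj hq' hq he).1
            omega
        · rcases Nat.lt_succ_iff_lt_or_eq.1 hq' with hq' | rfl
          · rw [Function.update_of_ne (by omega)]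
            exact hI₃ q' hq'
          · simp
      have halt : altExpr.eval s₂ = q / (n + 1) := by
        simp [altExpr, Expr.eval, hcol, hs₂.slots]
      have hslot : slotExpr.eval s₂ = q % (n + 1) := by
        simp only [slotExpr, Expr.eval, halt, hcol, hs₂.slots]
        rw [Nat.mod_eq_sub_div_mul]
      have habove : (aboveExpr veto).eval s₂ ≠ 0 ↔ Above veto c (q / (n + 1)) := by
        cases veto <;> simp [aboveExpr, Above, Expr.eval, halt, hs₂.cand] <;> omega
      have hc : r < n → costExpr.eval s₂ = cost r (q / (n + 1)) := fun hrn => by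
        simp only [costExpr, Expr.eval, g1, hs₂.alts, halt, g3]
        exact hcost r hrn _ (Nat.div_lt_of_lt_mul (by rwa [mul_comm, ← hN]))
      refine Runs.cond (k := 3) (fun h1 => ?_) fun h1 => ?_
      · simp only [Expr.eval, hs₂.voters, g1] at h1
        have hrn : r < n := by omega
        refine Runs.cond (k := 2) (fun h2 => ?_) fun h2 => Runs.cond (k := 1) (fun h3 => ?_)
          fun h3 => ?_
        · refine (set _ ?_).mono (by omega) fun _ _ h => h
          rw [hc hrn, hW, barMatrix, if_pos hrn, if_neg (by tauto)]
        · simp only [Expr.eval, hslot, g2] at h3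
          refine (set _ ?_).mono (by omega) fun _ _ h => h
          have h2' := mt habove.2 (not_not.2 h2)
          simp only [Expr.eval, hs₂.inf]
          rw [hW, barMatrix, if_pos hrn, if_pos ⟨h2', by omega⟩]
        · simp only [Expr.eval, hslot, g2] at h3
          refine (set _ ?_).mono (by omega) fun _ _ h => h
          rw [hc hrn, hW, barMatrix, if_pos hrn, if_neg (fun h => by omega)]
      · simp only [Expr.eval, hs₂.voters, g1] at h1
        have hrn : ¬ r < n := by omega
        refine Runs.cond (k := 2) (fun h2 => Runs.cond (k := 1) (fun h3 => ?_)
          fun h3 => ?_) fun h2 => ?_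
        · simp only [Expr.eval, hslot, g2] at h3
          refine (set _ ?_).mono (by omega) fun _ _ h => h
          simp only [Expr.eval, hs₂.inf]
          rw [hW, barMatrix, if_neg hrn, if_pos ⟨habove.1 h2, by omega⟩]
        · simp only [Expr.eval, hslot, g2] at h3
          refine (set _ ?_).mono (by omega) fun _ _ h => h
          simp only [Expr.eval]
          rw [hW, barMatrix, if_neg hrn, if_neg (fun h => by omega)]
        · refine (set _ ?_).mono (by omega) fun _ _ h => h
          have h2' := mt habove.2 (not_not.2 h2)
          simp only [Expr.eval]
          rw [hW, barMatrix, if_neg hrn, if_neg (by tauto)]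
    · rintro s₂ - ⟨hI₂, hI₃⟩
      simp only [Memory.write_of_ne, ne_eq, Nat.reduceEqDiff, not_false_eq_true]
      intro r' hr'
      rcases Nat.lt_succ_iff_lt_or_eq.1 hr' with hr' | rfl
      · exact hI₂ r' hr'
      · exact hI₃
  · refine ⟨?_, hI⟩
    rw [hf vCols (by decide) (by simp [Program.mods, Program.forLoop, setEntry]), hs.cols]

/-- A bound on the number of instructions for an instance whose parameters are bounded by `M`. -/
def decideBound (M : ℕ) : ℕ :=
  M * (M * (M * 7 + 6) + solveBound M + 10) + M * (M * 6 + 6) + M * 9 + 29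

/-- The assignment problem for some bar has a solution within the budget. -/
def Solvable (veto : Bool) (m n c B : ℕ) (cost : ℕ → ℕ → ℕ) : Prop :=
  ∃ K < n + 1, ∃ σ, IsAssignment (m * (n + 1)) σ ∧
    ∑ r ∈ range (m * (n + 1)), barMatrix veto n (n + 1) c (B + 1) K cost r (σ r) ≤ B

theorem barMatrix_le {K : ℕ} {cost : ℕ → ℕ → ℕ} {r q : ℕ} (hq : q < m * (n + 1))
    (hcost : ∀ i < n, ∀ b < m, cost i b ≤ inf) :
    barMatrix veto n (n + 1) c inf K cost r q ≤ inf := by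
  unfold barMatrix
  split_ifs with h1
  · exact le_rfl
  · exact hcost r h1 _ (Nat.div_lt_of_lt_mul (by rwa [mul_comm]))
  · exact le_rfl
  · exact Nat.zero_le _

theorem placeCost_le {d q k : ℕ} : placeCost veto κ m inf d q k ≤ inf := by
  unfold placeCost
  dsimp only
  split_ifs <;> omega

theorem tryBars_runs {cost : ℕ → ℕ → ℕ} (hs : HasSizes s m n c (B + 1))
    (hcost : ∀ i < n, ∀ b < m, s arrCost (i * m + b) = cost i b)
    (hle : ∀ i < n, ∀ b < m, cost i b ≤ B + 1)
    {T : ℕ} (hT : s vPhases 0 = T) (hT0 : T ≠ 0) (hTM : T ≤ M)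
    (hP : s vScale 0 = 2 ^ T) (hX : (m * (n + 1) + 1) * (B + 1) < 2 ^ T)
    (hM : m * (n + 1) ≤ M) (hn : n + 1 ≤ M) (hout : s 1 0 = 0) :
    Runs (tryBars veto) s (M * (M * (M * 7 + 6) + solveBound M + 10) + 3) fun s' =>
      s' 1 0 = 1 ↔ Solvable veto m n c B cost := by
  refine Runs.mono (k := M * ((M * (M * 7 + 6) + 3) + (solveBound M + 2 + 1) + 1 + 3) + 3)
    (Runs.forLoop (n + 1) M (fun i s' => s' 1 0 = 1 ↔ ∃ K < i, ∃ σ,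
      IsAssignment (m * (n + 1)) σ ∧
      ∑ r ∈ range (m * (n + 1)), barMatrix veto n (n + 1) c (B + 1) K cost r (σ r) ≤ B)
    hs.slots hn (by cases veto <;> decide) (by cases veto <;> decide) (by decide) ?_ ?_
      fun _ _ h => h) (by ring_nf; omega) fun _ _ h => h
  · simp [Memory.write_of_ne, hout]
  intro K s₁ hK hbar hf₁ hI
  have frame₁ : ∀ a ∈ [vAlts, vVoters, vCand, vInf, vSlots, vCols, vPhases, vScale, arrCost],
      s₁ a = s a := fun a ha => by
    cases veto <;> exact hf₁ a (by revert a; decide) (by revert a; decide)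
  have hs₁ : HasSizes s₁ m n c (B + 1) := hs.congr fun a ha => frame₁ a (by revert a; decide)
  refine Runs.seq ((buildMatrix_runs hs₁ (by rw [frame₁ _ (by decide)]; exact hcost) hbar
    hM).mono le_rfl fun s₂ hf₂ hmat => ?_)
  have frame₂ : ∀ a ∈ [1, vInf, vPhases, vScale], s₂ a = s₁ a := fun a ha => by
    cases veto <;> exact hf₂ a (by revert a; decide)
  refine Runs.seq ((solve_runs (T := T) hmat ?_ hT0 ?_ ?_ hM hTM).mono le_rfl ?_)
  · rw [frame₂ _ (by decide), frame₁ _ (by decide), hT]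
  · rw [frame₂ _ (by decide), frame₁ _ (by decide), hP]
  · intro r _ q hq
    refine lt_of_le_of_lt ?_ hX
    rw [mul_comm]
    exact Nat.mul_le_mul_left _ (barMatrix_le hq hle)
  rintro s₃ hf₃ ⟨⟨π, hπ, h1⟩, h2⟩
  have g1 : s₃ vInf 0 = B + 1 := by rw [hf₃ vInf (by decide), frame₂ _ (by decide), hs₁.inf]
  have g2 : s₃ 1 0 = s₁ 1 0 := by rw [hf₃ 1 (by decide), frame₂ _ (by decide)]
  refine Runs.cond (fun h => Runs.assign ?_) fun h => Runs.skip ?_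
  all_goals simp only [Expr.eval, g1] at h
  · simp only [Expr.eval, Memory.write_of_ne, Memory.write_self, ne_eq, OfNat.one_ne_ofNat,
      not_false_eq_true, Function.update_self, true_iff]
    exact ⟨K, by omega, π, hπ, by omega⟩
  · simp only [Memory.write_of_ne, ne_eq, OfNat.one_ne_ofNat, not_false_eq_true, g2, hI]
    constructor
    · rintro ⟨K', hK', h3⟩
      exact ⟨K', by omega, h3⟩
    · rintro ⟨K', hK', σ, hσ, h3⟩
      rcases Nat.lt_succ_iff_lt_or_eq.1 hK' with hK' | rfl
      · exact ⟨K', hK', σ, hσ, h3⟩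
      · have := h2 σ hσ
        omega

theorem decideBribery_runs (h : HasInput s m n c B δ p alt pos) (hout : s 1 0 = 0) (hm : m ≤ M)
    (hn : n + 1 ≤ M) (hN : m * (n + 1) ≤ M)
    (hsize : Nat.size ((m * (n + 1) + 1) * (B + 1)) ≤ M) :
    Runs (decideBribery veto κ) s (decideBound M) fun s' => s' 1 0 = 1 ↔
      Solvable veto m n c B fun i b => placeCost veto κ m (B + 1) (δ i) (p i) (pos i b) := by
  refine Runs.mono (k := (M * 4 + 15) + ((M * (M * 6 + 6) + 3) + ((M * 5 + 5) +
    (M * (M * (M * 7 + 6) + solveBound M + 10) + 3) + 1) + 1) + 1) ?_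
    (by unfold decideBound; omega) fun _ _ h => h
  refine Runs.seq ((readSizes_runs h hm).mono le_rfl fun s₁ hf₁ hs₁ => ?_)
  have g1 : s₁ 0 = s 0 := hf₁ 0 (by decide)
  have h₁ : HasInput s₁ m n c B δ p alt pos := by
    obtain ⟨h1, h2, h3, h4, h5, h6, h7, h8⟩ := h
    constructor <;> first | assumption | (rw [g1]; assumption)
  refine Runs.seq ((readCosts_runs h₁ hs₁ hm (by omega)).mono le_rfl fun s₂ hf₂ hc₂ => ?_)
  have hs₂ : HasSizes s₂ m n c (B + 1) := hs₁.congr fun a ha => hf₂ a (by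
    rw [readCosts_mods]; revert a; decide)
  refine Runs.seq ((findScale_runs hs₂ hsize (by omega)).mono le_rfl ?_)
  rintro s₃ hf₃ ⟨T, h1, h2, h3, h4, h5⟩
  have hs₃ : HasSizes s₃ m n c (B + 1) := hs₂.congr fun a ha => hf₃ a (by revert a; decide)
  refine tryBars_runs hs₃ (by rw [hf₃ arrCost (by decide)]; exact hc₂)
    (fun _ _ _ _ => placeCost_le) h1 h2 h3 h4 h5 hN hn ?_
  rw [hf₃ 1 (by decide), hf₂ 1 (by rw [readCosts_mods]; decide), hf₁ 1 (by decide), hout]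

theorem decideBribery_tame : (decideBribery veto κ).Tame := by
  simp [decideBribery, readSizes, readCosts, findScale, tryBars, buildMatrix, solve, phase,
    enterRow, bid, findBest, setCost, setEntry, costExpr, entryExpr, Program.forLoop,
    Program.Tame, Expr.Tame]

end Bribery

/-! ### From the assignment problem to elections -/

namespace Bribery

open Auction Finset

variable {m n c B : ℕ} {veto : Bool}

theorem exists_count_eq (p : ℕ → Prop) [DecidablePred p] (n : ℕ) {k : ℕ}
    (hk : k < Nat.count p n) : ∃ r < n, p r ∧ Nat.count p r = k := by
  induction n with
  | zero => simp at hk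
  | succ n ih =>
    rw [Nat.count_succ] at hk
    by_cases h : k < Nat.count p n
    · obtain ⟨r, h1, h2⟩ := ih h
      exact ⟨r, by omega, h2⟩
    · split_ifs at hk with hp
      · exact ⟨n, by omega, hp, by omega⟩
      · omega

/-- An assignment of voters and dummies to slots is, up to the order of the slots of an alternative,
a choice of alternatives by the voters that respects the bar. -/
theorem solvable_iff {cost : ℕ → ℕ → ℕ} (hc : c < m) :
    Solvable veto m n c B cost ↔ ∃ f : ℕ → ℕ, (∀ r < n, f r < m) ∧
      ∑ r ∈ range n, cost r (f r) ≤ B ∧ ∃ K < n + 1, ∀ b < m,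
        (Above veto c b → K < Nat.count (fun r => f r = b) n) ∧
        (¬ Above veto c b → Nat.count (fun r => f r = b) n ≤ K) := by
  have hnN : n ≤ m * (n + 1) := by nlinarith
  constructor
  · rintro ⟨K, hK, σ, hσ, hsum⟩
    have hent : ∀ r < m * (n + 1),
        barMatrix veto n (n + 1) c (B + 1) K cost r (σ r) ≠ B + 1 := fun r hr h => by
      have := single_le_sum (f := fun r => barMatrix veto n (n + 1) c (B + 1) K cost r (σ r))
        (fun _ _ => Nat.zero_le _) (mem_range.2 hr)
      omega
    have hvoter : ∀ r < n, ¬ (¬ Above veto c (σ r / (n + 1)) ∧ K ≤ σ r % (n + 1)) := by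
      intro r hr h
      apply hent r (by omega)
      rw [barMatrix, if_pos hr, if_pos h]
    have hinj : ∀ r < n, ∀ r' < n, σ r / (n + 1) = σ r' / (n + 1) →
        σ r % (n + 1) = σ r' % (n + 1) → r = r' := by
      intro r hr r' hr' h1 h2
      apply hσ.inj r (by omega) r' (by omega)
      rw [← Nat.div_add_mod (σ r) (n + 1), ← Nat.div_add_mod (σ r') (n + 1), h1, h2]
    refine ⟨fun r => σ r / (n + 1), fun r hr => ?_, ?_, K, hK, fun b hb => ⟨fun hab => ?_,
      fun hab => ?_⟩⟩
    · exact Nat.div_lt_of_lt_mul (by rw [mul_comm]; exact hσ.lt r (by omega))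
    · calc ∑ r ∈ range n, cost r (σ r / (n + 1))
          = ∑ r ∈ range n, barMatrix veto n (n + 1) c (B + 1) K cost r (σ r) :=
            sum_congr rfl fun r hr => by
              have hr' := mem_range.1 hr
              rw [barMatrix, if_pos hr', if_neg (hvoter r hr')]
        _ ≤ ∑ r ∈ range (m * (n + 1)), barMatrix veto n (n + 1) c (B + 1) K cost r (σ r) :=
            sum_le_sum_of_subset (range_subset_range.2 hnN)
        _ ≤ B := hsum
    · -- The slots `0, …, K` of `b` are not taken by dummies.
      rw [Nat.count_eq_card_filter_range]
      beta_reduce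
      have : range (K + 1) ⊆
          ((range n).filter fun r => σ r / (n + 1) = b).image fun r => σ r % (n + 1) := by
        intro k hk
        rw [mem_range] at hk
        have hq : b * (n + 1) + k ∈ (range (m * (n + 1))).image σ := by
          rw [hσ.image, mem_range]
          nlinarith
        obtain ⟨r, hr, hrq⟩ := mem_image.1 hq
        rw [mem_range] at hr
        have h1 : σ r / (n + 1) = b := by
          rw [hrq, mul_comm, Nat.mul_add_div (by omega), Nat.div_eq_of_lt (by omega), add_zero]
        have h2 : σ r % (n + 1) = k := by
          rw [hrq, mul_comm, Nat.mul_add_mod, Nat.mod_eq_of_lt (by omega)]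
        refine mem_image.2 ⟨r, mem_filter.2 ⟨mem_range.2 ?_, h1⟩, h2⟩
        by_contra hrn
        apply hent r hr
        rw [barMatrix, if_neg hrn, if_pos ⟨by rwa [h1], by omega⟩]
      have h1 := (card_le_card this).trans card_image_le
      rw [card_range] at h1
      omega
    · -- The voters at `b` are in different slots among `0, …, K - 1`.
      rw [Nat.count_eq_card_filter_range, ← card_range K]
      beta_reduce
      refine card_le_card_of_injOn (fun r => σ r % (n + 1)) (fun r hr => ?_) fun r hr r' hr' h => ?_
      · obtain ⟨h1, h2⟩ := mem_filter.1 hr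
        have := hvoter r (mem_range.1 h1)
        rw [show σ r / (n + 1) = b from h2] at this
        simp only [coe_range, Set.mem_Iio]
        by_contra h
        exact this ⟨hab, by omega⟩
      · obtain ⟨h1, h2⟩ := mem_filter.1 hr
        obtain ⟨h1', h2'⟩ := mem_filter.1 hr'
        exact hinj r (mem_range.1 h1) r' (mem_range.1 h1') (h2.trans h2'.symm) h
  · rintro ⟨f, hf, hsum, K, hK, hbar⟩
    set N := m * (n + 1) with hN
    -- A voter is put into the slot numbered by the earlier voters with the same choice.
    set slot : ℕ → ℕ := fun r => Nat.count (fun r' => f r' = f r) r with hslot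
    have hslot_lt : ∀ r < n, slot r < Nat.count (fun r' => f r' = f r) n := fun r hr =>
      Nat.count_strict_mono (p := fun r' => f r' = f r) rfl hr
    have hslot_le : ∀ r < n, slot r < n + 1 := fun r hr =>
      (Nat.count_le (p := fun r' => f r' = f r)).trans_lt (by omega)
    have hex : ∃ g : Fin N ≃ range N, ∀ r ∈ univ.filter (fun r : Fin N => (r : ℕ) < n),
        (g r : ℕ) = f r * (n + 1) + slot r := by
      refine Finset.exists_equiv_extend_of_card_eq (f := fun r : Fin N => f r * (n + 1) + slot r)
        (by simp) ?_ ?_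
      · intro q hq
        obtain ⟨r, hr, rfl⟩ := mem_image.1 hq
        have hr' := (mem_filter.1 hr).2
        have h1 := hf r hr'
        have h2 := hslot_le r hr'
        rw [mem_range]
        nlinarith
      · intro r hr r' hr' h
        simp only [coe_filter, mem_univ, true_and, Set.mem_ofPred_eq] at hr hr'
        obtain ⟨h1, h2⟩ := row_index_inj (hslot_le r hr) (hslot_le r' hr') h
        simp only [hslot, h1] at h2
        exact Fin.ext (Nat.count_injective (p := fun x => f x = f r') h1 rfl h2)
    obtain ⟨g, hg⟩ := hex
    set σ : ℕ → ℕ := fun r => if h : r < N then (g ⟨r, h⟩ : ℕ) else 0 with hσ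
    have hσv : ∀ r < n, σ r = f r * (n + 1) + slot r := fun r hr => by
      have hrN : r < N := by omega
      simp only [hσ, dif_pos hrN]
      exact hg ⟨r, hrN⟩ (by simpa using hr)
    have hass : IsAssignment N σ := by
      refine ⟨fun r hr => ?_, fun r hr r' hr' h => ?_⟩
      · simp only [hσ, dif_pos hr]
        exact mem_range.1 (g ⟨r, hr⟩).2
      · simp only [hσ, dif_pos hr, dif_pos hr'] at h
        simpa using g.injective (Subtype.ext h)
    refine ⟨K, hK, σ, hass, ?_⟩
    calc ∑ r ∈ range N, barMatrix veto n (n + 1) c (B + 1) K cost r (σ r)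
        = ∑ r ∈ range N, if r < n then cost r (f r) else 0 := ?_
      _ = ∑ r ∈ range n, cost r (f r) := ?_
      _ ≤ B := hsum
    · refine sum_congr rfl fun r hr => ?_
      rw [mem_range] at hr
      unfold barMatrix
      split_ifs with h1 h2 h3
      · rw [hσv r h1, mul_comm, Nat.mul_add_div (by omega), Nat.mul_add_mod,
          Nat.div_eq_of_lt (hslot_le r h1), Nat.mod_eq_of_lt (hslot_le r h1), add_zero] at h2
        have := (hbar (f r) (hf r h1)).2 h2.1
        have := hslot_lt r h1
        omega
      · rw [hσv r h1, mul_comm, Nat.mul_add_div (by omega), Nat.div_eq_of_lt (hslot_le r h1),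
          add_zero]
      · exfalso
        have hb : σ r / (n + 1) < m :=
          Nat.div_lt_of_lt_mul (by rw [mul_comm]; exact hass.lt r hr)
        have hlt := (hbar _ hb).1 h3.1
        obtain ⟨r', hr', h4, h5⟩ := exists_count_eq _ n (h3.2.trans_lt hlt)
        have h6 : σ r' = σ r := by
          rw [hσv r' hr', hslot]
          simp only [h4, h5]
          rw [mul_comm, Nat.div_add_mod]
        have := hass.inj r' (by omega) r hr h6
        omega
      · rfl
    · rw [← sum_filter]
      congr 1
      ext r
      simp only [mem_filter, mem_range]
      omega

end Bribery

/-! ### Moving an alternative to the first or to the last place -/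

namespace Election

open Finset

/-- Under the distance `d`, moving an alternative `k` places up to the top costs exactly `κ * k`;
moreover `d` does not change when both preferences are reversed, so that the same holds for moves to
the bottom. -/
structure TopDistance (d : Distance) (κ : ℕ) : Prop where
  le : ∀ {m : ℕ} (P Q : Preference m) (b : Fin m), (Q b : ℕ) = 0 → κ * (P b : ℕ) ≤ d m P Q
  exists_le : ∀ {m : ℕ} (P : Preference m) (b : Fin m),
    ∃ Q : Preference m, (Q b : ℕ) = 0 ∧ d m P Q ≤ κ * (P b : ℕ)
  rev : ∀ {m : ℕ} (P Q : Preference m), d m (P.trans Fin.revPerm) (Q.trans Fin.revPerm) = d m P Q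

/-- The preference in which `b` is moved to the top and the alternatives above it move down. -/
def toTop {m : ℕ} (P : Preference m) (b : Fin m) : Preference m := P.trans (P b).cycleRange

theorem toTop_self {m : ℕ} (P : Preference m) (b : Fin m) : (toTop P b b : ℕ) = 0 := by
  have : NeZero m := ⟨by have := b.2; omega⟩
  simp [toTop, Fin.cycleRange_self]

theorem toTop_of_lt {m : ℕ} (P : Preference m) {a b : Fin m} (h : P a < P b) :
    (toTop P b a : ℕ) = P a + 1 := by
  simpa [toTop] using Fin.coe_cycleRange_of_lt h

theorem toTop_of_gt {m : ℕ} (P : Preference m) {a b : Fin m} (h : P b < P a) :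
    toTop P b a = P a := by
  simpa [toTop] using Fin.cycleRange_of_gt h

theorem card_above {m : ℕ} (P : Preference m) (b : Fin m) :
    (univ.filter fun a => P a < P b).card = P b := by
  have : (P b : ℕ) + 1 = (univ.filter fun a => P a < P b).card + 1 := P.pos_eq b
  omega

theorem eq_or_lt_or_gt {m : ℕ} (P : Preference m) (a b : Fin m) :
    a = b ∨ P a < P b ∨ P b < P a := by
  rcases lt_trichotomy (P a) (P b) with h | h | h
  · exact Or.inr (Or.inl h)
  · exact Or.inl (P.injective h)
  · exact Or.inr (Or.inr h)

theorem pos_rev {m : ℕ} (P : Preference m) (a : Fin m) :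
    (Preference.pos (P.trans Fin.revPerm) a : ℤ) = m + 1 - P.pos a := by
  have := (P a).2
  simp only [Preference.pos, Equiv.trans_apply, Fin.revPerm_apply, Fin.val_rev]
  omega

theorem natAbs_pos_rev {m : ℕ} (P Q : Preference m) (a : Fin m) :
    ((Preference.pos (P.trans Fin.revPerm) a : ℤ) -
      (Preference.pos (Q.trans Fin.revPerm) a : ℤ)).natAbs =
    ((P.pos a : ℤ) - (Q.pos a : ℤ)).natAbs := by
  rw [pos_rev, pos_rev]
  omega

theorem topDistance_swap : TopDistance swapDistance 1 where
  le {m} P Q b hb := by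
    rw [one_mul, ← card_above P b]
    refine card_le_card_of_injOn (fun a => (a, b)) (fun a ha => ?_) fun a _ a' _ h =>
      (Prod.mk.inj h).1
    have ha' : P a < P b := by simpa using ha
    have hab : Q a ≠ Q b := fun h => absurd ha' (by simp [Q.injective h])
    have : (Q a : ℕ) ≠ Q b := fun h => hab (Fin.ext h)
    exact mem_filter.2 ⟨mem_univ _, ha', Fin.lt_def.2 (by dsimp only; omega)⟩
  exists_le {m} P b := by
    refine ⟨toTop P b, toTop_self P b, ?_⟩
    rw [one_mul, ← card_above P b]
    -- Only pairs with second member `b` change their order.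
    have key : ∀ x y : Fin m, P x < P y → toTop P b y < toTop P b x → y = b ∧ P x < P b := by
      intro x y hxy hyx
      rw [Fin.lt_def] at hyx
      rcases eq_or_lt_or_gt P y b with rfl | hy | hy
      · exact ⟨rfl, hxy⟩
      · rw [toTop_of_lt P hy, toTop_of_lt P (hxy.trans hy)] at hyx
        have := Fin.lt_def.1 hxy
        omega
      · rw [toTop_of_gt P hy] at hyx
        have := Fin.lt_def.1 hxy
        rcases eq_or_lt_or_gt P x b with rfl | hx | hx
        · rw [toTop_self] at hyx; omega
        · rw [toTop_of_lt P hx] at hyx; omega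
        · rw [toTop_of_gt P hx] at hyx; omega
    refine card_le_card_of_injOn Prod.fst (fun x hx => ?_) fun x hx y hy h => ?_
    · obtain ⟨-, h1, h2⟩ := mem_filter.1 hx
      exact mem_filter.2 ⟨mem_univ _, (key _ _ h1 h2).2⟩
    · obtain ⟨-, h1, h2⟩ := mem_filter.1 hx
      obtain ⟨-, h1', h2'⟩ := mem_filter.1 hy
      exact Prod.ext h ((key _ _ h1 h2).1.trans (key _ _ h1' h2').1.symm)
  rev {m} P Q := by
    refine card_bij' (fun x _ => x.swap) (fun x _ => x.swap) ?_ ?_ (fun _ _ => rfl)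
      fun _ _ => rfl
    all_goals
      rintro ⟨a, b⟩ h
      obtain ⟨-, h1, h2⟩ := mem_filter.1 h
      simp only [Preference.Prefers, Equiv.trans_apply, Fin.revPerm_apply, Fin.rev_lt_rev] at h1 h2
      refine mem_filter.2 ⟨mem_univ _, ?_, ?_⟩
      all_goals
        simp only [Preference.Prefers, Equiv.trans_apply, Fin.revPerm_apply, Fin.rev_lt_rev,
          Prod.fst_swap, Prod.snd_swap]
        assumption

theorem topDistance_maxDisplacement : TopDistance maxDisplacementDistance 1 where
  le {m} P Q b hb := by
    refine le_trans ?_ (le_sup (f := fun a => ((P.pos a : ℤ) - (Q.pos a : ℤ)).natAbs) (mem_univ b))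
    simp only [Preference.pos]
    omega
  exists_le {m} P b := by
    refine ⟨toTop P b, toTop_self P b, Finset.sup_le fun a _ => ?_⟩
    simp only [Preference.pos]
    rcases eq_or_lt_or_gt P a b with rfl | h | h
    · rw [toTop_self]; omega
    · rw [toTop_of_lt P h]
      have := Fin.lt_def.1 h
      omega
    · rw [toTop_of_gt P h]; omega
  rev {m} P Q := by
    simp only [maxDisplacementDistance, natAbs_pos_rev]

theorem sum_pos {m : ℕ} (P : Preference m) :
    ∑ a, (P.pos a : ℤ) = ∑ a : Fin m, ((a : ℕ) + 1 : ℤ) := by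
  rw [← Equiv.sum_comp P fun a : Fin m => ((a : ℕ) + 1 : ℤ)]
  simp [Preference.pos]

theorem topDistance_footrule : TopDistance footruleDistance 2 where
  le {m} P Q b hb := by
    -- The displacements sum to zero, so that the other alternatives make up for `b`.
    have h0 : ∑ a, ((P.pos a : ℤ) - (Q.pos a : ℤ)) = 0 := by
      rw [sum_sub_distrib, sum_pos, sum_pos, sub_self]
    rw [← add_sum_erase _ _ (mem_univ b)] at h0
    have h1 : ∑ a ∈ univ.erase b, -((P.pos a : ℤ) - (Q.pos a : ℤ)) ≤
        ∑ a ∈ univ.erase b, (((P.pos a : ℤ) - (Q.pos a : ℤ)).natAbs : ℤ) :=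
      sum_le_sum fun a _ => by omega
    rw [sum_neg_distrib] at h1
    have h2 : footruleDistance m P Q = ((P.pos b : ℤ) - (Q.pos b : ℤ)).natAbs +
        ∑ a ∈ univ.erase b, ((P.pos a : ℤ) - (Q.pos a : ℤ)).natAbs :=
      (add_sum_erase _ _ (mem_univ b)).symm
    have h3 : (P.pos b : ℤ) - (Q.pos b : ℤ) = (P b : ℕ) := by
      simp only [Preference.pos]; omega
    zify at h2 ⊢
    rw [h3] at h0
    rw [h3] at h2
    have h4 : |((P b : ℕ) : ℤ)| = (P b : ℕ) := abs_of_nonneg (by omega)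
    have h5 : ∀ x : ℤ, ((x.natAbs : ℕ) : ℤ) = |x| := fun x => by simp
    simp only [h5] at h1
    rw [h2, h4]
    linarith
  exists_le {m} P b := by
    refine ⟨toTop P b, toTop_self P b, ?_⟩
    have h : ∀ a, ((P.pos a : ℤ) - ((toTop P b).pos a : ℤ)).natAbs =
        (if a = b then (P b : ℕ) else 0) + if P a < P b then 1 else 0 := by
      intro a
      simp only [Preference.pos]
      rcases eq_or_lt_or_gt P a b with rfl | h | h
      · rw [toTop_self]; simp
      · rw [toTop_of_lt P h, if_pos h, if_neg (fun h' => absurd h (by simp [h']))]; omega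
      · rw [toTop_of_gt P h, if_neg h.not_gt, if_neg (fun h' => absurd h (by simp [h']))]; omega
    simp only [footruleDistance, h, sum_add_distrib, sum_ite_eq', mem_univ, if_true]
    rw [← card_filter, card_above]
    omega
  rev {m} P Q := by
    simp only [footruleDistance, natAbs_pos_rev]

/-- The number of places from the alternative `b` to the first place, or for veto to the last. -/
def place (veto : Bool) {m : ℕ} (P : Preference m) (b : Fin m) : ℕ :=
  if veto then m - 1 - P b else P b

theorem TopDistance.place_le {d : Distance} {κ : ℕ} (hd : TopDistance d κ) (veto : Bool) {m : ℕ}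
    (P Q : Preference m) (b : Fin m) (h : place veto Q b = 0) : κ * place veto P b ≤ d m P Q := by
  cases veto
  · exact hd.le P Q b h
  · have h' : ((Q.trans Fin.revPerm) b : ℕ) = 0 := by
      simp [place, Fin.val_rev] at h ⊢; omega
    have := hd.le (P.trans Fin.revPerm) (Q.trans Fin.revPerm) b h'
    rw [hd.rev] at this
    refine le_trans (Nat.mul_le_mul_left _ ?_) this
    simp [place, Fin.val_rev]; omega

theorem TopDistance.exists_place {d : Distance} {κ : ℕ} (hd : TopDistance d κ) (veto : Bool) {m : ℕ}
    (P : Preference m) (b : Fin m) :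
    ∃ Q : Preference m, place veto Q b = 0 ∧ d m P Q ≤ κ * place veto P b := by
  cases veto
  · exact hd.exists_le P b
  · obtain ⟨Q, h1, h2⟩ := hd.exists_le (P.trans Fin.revPerm) b
    refine ⟨Q.trans Fin.revPerm, ?_, ?_⟩
    · simp [place, Fin.val_rev, h1]
    · rw [← hd.rev]
      have h3 : (Q.trans Fin.revPerm).trans Fin.revPerm = Q := by ext; simp
      rw [h3]
      refine h2.trans (Nat.mul_le_mul_left _ ?_)
      simp [place, Fin.val_rev]; omega

theorem exists_place_eq_zero (veto : Bool) {m : ℕ} (c : Fin m) (P : Preference m) :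
    ∃ b, place veto P b = 0 := by
  have := c.2
  cases veto
  · exact ⟨P.symm ⟨0, by omega⟩, by simp [place]⟩
  · exact ⟨P.symm ⟨m - 1, by omega⟩, by simp [place]⟩

theorem place_inj (veto : Bool) {m : ℕ} (P : Preference m) {a b : Fin m}
    (ha : place veto P a = 0) (hb : place veto P b = 0) : a = b := by
  apply P.injective
  apply Fin.ext
  have h1 := (P a).2
  have h2 := (P b).2
  cases veto
  · simp [place] at ha hb; omega
  · simp [place] at ha hb; omega

/-! ### Unique winners -/

theorem scoringRule_eq_singleton {α : ℕ → ℕ → ℕ} {m n : ℕ} {P : Profile m n} {c : Fin m} :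
    scoringRule α m n P = {c} ↔ ∀ b, b ≠ c →
      ∑ i, α m ((P i).pos b) < ∑ i, α m ((P i).pos c) := by
  simp only [scoringRule, Finset.ext_iff, mem_filter, mem_univ, true_and, mem_singleton]
  constructor
  · intro h b hb
    have hc := (h c).2 rfl
    have hb' := mt (h b).1 hb
    push Not at hb'
    obtain ⟨a, ha⟩ := hb'
    exact ha.trans_le (hc a)
  · intro h b
    constructor
    · intro hb
      by_contra hbc
      exact absurd (hb c) (h b hbc).not_ge
    · rintro rfl a
      by_cases ha : a = b
      · rw [ha]
      · exact (h a ha).le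

/-- Veto or plurality, depending on the flag. -/
def rule (veto : Bool) : VotingRule := if veto then Election.veto else plurality

/-- The number of voters choosing `b`. -/
def votes {m n : ℕ} (f : Fin n → Fin m) (b : Fin m) : ℕ := ∑ i, if f i = b then 1 else 0

/-- The alternative `c` beats `b` when the voters choose their top, or for veto their last,
alternatives according to `f`. -/
def Beats (veto : Bool) {m n : ℕ} (f : Fin n → Fin m) (c b : Fin m) : Prop :=
  if veto then votes f c < votes f b else votes f b < votes f c

theorem rule_eq_singleton (veto : Bool) {m n : ℕ} {P : Profile m n} {f : Fin n → Fin m}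
    (hf : ∀ i, place veto (P i) (f i) = 0) {c : Fin m} :
    rule veto m n P = {c} ↔ ∀ b, b ≠ c → Beats veto f c b := by
  have hiff : ∀ i b, f i = b ↔ place veto (P i) b = 0 := fun i b =>
    ⟨fun h => h ▸ hf i, fun h => place_inj veto (P i) (hf i) h⟩
  cases veto
  · simp only [rule, plurality, Bool.false_eq_true, if_false, Beats, scoringRule_eq_singleton]
    have : ∀ b, ∑ i, approvalVector (fun _ => 1) m ((P i).pos b) = votes f b := fun b => by
      refine sum_congr rfl fun i _ => ?_
      simp only [approvalVector, Preference.pos, hiff, place]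
      simp
    simp only [this]
  · simp only [rule, Election.veto, if_true, Beats, scoringRule_eq_singleton]
    have : ∀ b, ∑ i, approvalVector (fun m => m - 1) m ((P i).pos b) + votes f b = n :=
      fun b => by
      rw [votes, ← sum_add_distrib]
      calc _ = ∑ _i : Fin n, 1 := sum_congr rfl fun i _ => by
              have := (P i b).2
              have h1 : approvalVector (fun m => m - 1) m ((P i).pos b) =
                if (P i b : ℕ) + 1 ≤ m - 1 then 1 else 0 := rfl
              rw [h1]
              simp only [hiff, place, if_true]
              split_ifs <;> omega
        _ = n := by simp
    refine forall_congr' fun b => imp_congr_right fun _ => ?_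
    have h1 := this b
    have h2 := this c
    omega

/-- A bribery is a choice of top (or last) alternatives: no voter needs to be paid for anything else
than a new top (or last) alternative. -/
theorem briberyPossible_iff (veto : Bool) {d : Distance} {κ : ℕ} (hd : TopDistance d κ)
    (I : BriberyInstance) :
    BriberyPossible (rule veto) d I ↔ ∃ f : Fin I.n → Fin I.m,
      ∑ i, Bribery.placeCost veto κ I.m (I.budget + 1) (I.δ i) (I.price i) (I.profile i (f i)) ≤
        I.budget ∧ ∀ b, b ≠ I.c → Beats veto f I.c b := by
  have hcost : ∀ i b, Bribery.placeCost veto κ I.m (I.budget + 1) (I.δ i) (I.price i)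
      (I.profile i b) = if place veto (I.profile i) b = 0 then 0 else
        if κ * place veto (I.profile i) b ≤ I.δ i then min (I.price i) (I.budget + 1)
        else I.budget + 1 := fun i b => rfl
  simp only [hcost]
  constructor
  · rintro ⟨J, Q, hJ, hQ, hr⟩
    choose f hf using fun i =>
      exists_place_eq_zero veto I.c (if i ∈ J then Q i else I.profile i)
    refine ⟨f, ?_, (rule_eq_singleton veto hf).1 hr⟩
    refine le_trans ?_ hJ
    rw [← sum_filter_add_sum_filter_not univ (· ∈ J) fun i => _, filter_mem_eq_inter, univ_inter]
    have h0 : ∑ i ∈ univ.filter (· ∉ J), (if place veto (I.profile i) (f i) = 0 then 0 else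
        if κ * place veto (I.profile i) (f i) ≤ I.δ i then min (I.price i) (I.budget + 1)
        else I.budget + 1) = 0 := by
      refine sum_eq_zero fun i hi => if_pos ?_
      have := hf i
      rwa [if_neg (mem_filter.1 hi).2] at this
    rw [h0, add_zero]
    refine sum_le_sum fun i hi => ?_
    have h1 := hf i
    rw [if_pos hi] at h1
    have h2 := (hd.place_le veto (I.profile i) (Q i) (f i) h1).trans (hQ i hi)
    rw [if_pos h2]
    split_ifs
    · exact Nat.zero_le _
    · exact min_le_left _ _
  · rintro ⟨f, hsum, hb⟩
    choose Q hQ1 hQ2 using fun i => hd.exists_place veto (I.profile i) (f i)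
    have hle : ∀ i, (if place veto (I.profile i) (f i) = 0 then 0 else
        if κ * place veto (I.profile i) (f i) ≤ I.δ i then min (I.price i) (I.budget + 1)
        else I.budget + 1) ≤ I.budget := fun i =>
      (single_le_sum (f := fun i => if place veto (I.profile i) (f i) = 0 then 0 else
        if κ * place veto (I.profile i) (f i) ≤ I.δ i then min (I.price i) (I.budget + 1)
        else I.budget + 1) (fun _ _ => Nat.zero_le _) (mem_univ i)).trans hsum
    have hmem : ∀ i, place veto (I.profile i) (f i) ≠ 0 →
        κ * place veto (I.profile i) (f i) ≤ I.δ i ∧ (I.price i) ≤ I.budget := by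
      intro i hi
      have := hle i
      rw [if_neg hi] at this
      split_ifs at this with h
      · exact ⟨h, by omega⟩
      · omega
    refine ⟨univ.filter fun i => place veto (I.profile i) (f i) ≠ 0, Q, ?_, fun i hi => ?_, ?_⟩
    · refine le_trans ?_ hsum
      rw [sum_filter]
      refine sum_le_sum fun i _ => ?_
      by_cases h : place veto (I.profile i) (f i) = 0
      · simp [h]
      · obtain ⟨h1, h2⟩ := hmem i h
        rw [if_pos h, if_neg h, if_pos h1]
        omega
    · exact (hQ2 i).trans (hmem i (mem_filter.1 hi).2).1
    · refine (rule_eq_singleton veto fun i => ?_).2 hb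
      by_cases h : place veto (I.profile i) (f i) = 0
      · simp [h]
      · simp [h, hQ1 i]

end Election

/-! ### Polynomial running time -/

namespace Election

open Finset RAM Bribery

/-- The extension of a function on `Fin n` to the natural numbers by the junk value `0`. -/
def extend {n : ℕ} (f : Fin n → ℕ) (i : ℕ) : ℕ := if h : i < n then f ⟨i, h⟩ else 0

theorem extend_of_lt {n : ℕ} (f : Fin n → ℕ) {i : ℕ} (h : i < n) : extend f i = f ⟨i, h⟩ :=
  dif_pos h

theorem extend_val {n : ℕ} (f : Fin n → ℕ) (i : Fin n) : extend f i = f i :=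
  dif_pos i.2

/-- A concatenation of blocks of the same length `L`, read at the place `j` of the block `i`. -/
theorem getD_flatMap {α : Type} (f : α → List ℕ) (L : ℕ) (hf : ∀ a, (f a).length = L)
    (l : List α) (i j : ℕ) (hi : i < l.length) (hj : j < L) :
    (l.flatMap f).getD (i * L + j) 0 = (f l[i]).getD j 0 := by
  induction l generalizing i with
  | nil => simp at hi
  | cons a l ih =>
    rw [List.flatMap_cons]
    cases i with
    | zero =>
      rw [List.getD_append _ _ _ _ (by rw [hf]; omega)]
      simp
    | succ i =>
      have h1 : (i + 1) * L = i * L + L := by ring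
      rw [List.getD_append_right _ _ _ _ (by rw [hf]; omega), hf]
      have h2 : (i + 1) * L + j - L = i * L + j := by omega
      rw [h2, ih i (by simpa using hi)]
      simp

/-- The block of the input that belongs to the voter `i`. -/
def voterBlock (I : BriberyInstance) (i : Fin I.n) : List ℕ :=
  [I.δ i, I.price i] ++ (List.finRange I.m).map fun k => ((I.profile i).symm k : ℕ)

theorem length_voterBlock (I : BriberyInstance) (i : Fin I.n) :
    (voterBlock I i).length = I.m + 2 := by
  simp [voterBlock]

theorem encode_eq (I : BriberyInstance) : I.encode =
    [I.m, I.n, (I.c : ℕ), I.budget] ++ (List.finRange I.n).flatMap (voterBlock I) := rfl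

theorem getD_encode (I : BriberyInstance) (i : Fin I.n) (j : ℕ) (hj : j < I.m + 2) :
    I.encode.getD (4 + i * (I.m + 2) + j) 0 = (voterBlock I i).getD j 0 := by
  rw [encode_eq, List.getD_append_right _ _ _ _ (by simp; omega)]
  have h : 4 + (i : ℕ) * (I.m + 2) + j - [I.m, I.n, (I.c : ℕ), I.budget].length =
      i * (I.m + 2) + j := by simp; omega
  rw [h, getD_flatMap _ _ (length_voterBlock I) _ _ _ (by simp) hj]
  simp

theorem hasInput_encode (I : BriberyInstance) :
    HasInput (initial I.encode) I.m I.n I.c I.budget (extend I.δ) (extend I.price)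
      (fun i k => extend (fun i => extend (fun k => ((I.profile i).symm k : ℕ)) k) i)
      (fun i b => extend (fun i => extend (fun b => (I.profile i b : ℕ)) b) i) where
  alts := rfl
  voters := rfl
  cand := rfl
  budget := rfl
  bound i hi := by
    have := getD_encode I ⟨i, hi⟩ 0 (by omega)
    simpa [initial, voterBlock, extend_of_lt _ hi] using this
  price i hi := by
    have := getD_encode I ⟨i, hi⟩ 1 (by omega)
    simpa [initial, voterBlock, extend_of_lt _ hi] using this
  place i hi k hk := by
    have := getD_encode I ⟨i, hi⟩ (2 + k) (by omega)
    rw [voterBlock, List.getD_append_right _ _ _ _ (by simp)] at this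
    simpa [initial, extend_of_lt _ hi, extend_of_lt _ hk, hk] using this
  alt_lt i hi k hk := by simp [extend_of_lt _ hi, extend_of_lt _ hk]
  pos_lt i hi b hb := by simp [extend_of_lt _ hi, extend_of_lt _ hb]
  alt_pos i hi b hb := by
    simp only [extend_of_lt _ hi, extend_of_lt _ hb]
    simp [extend_val]
  pos_alt i hi k hk := by
    simp only [extend_of_lt _ hi, extend_of_lt _ hk]
    simp [extend_val]

theorem votes_eq_count {m n : ℕ} (f : Fin n → Fin m) (b : Fin m) :
    votes f b = Nat.count (fun r => extend (fun i => (f i : ℕ)) r = b) n := by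
  rw [Nat.count_eq_card_filter_range, card_filter, Finset.sum_range, votes]
  refine sum_congr rfl fun i _ => ?_
  simp [extend_val, Fin.ext_iff]

theorem votes_le {m n : ℕ} (f : Fin n → Fin m) (b : Fin m) : votes f b ≤ n := by
  rw [votes_eq_count]
  exact Nat.count_le _

/-- The alternative `c` beats all others if and only if some bar separates it from them. -/
theorem beats_iff_exists_bar (veto : Bool) {m n : ℕ} (hn : 0 < n) (f : Fin n → Fin m) (c : Fin m) :
    (∀ b, b ≠ c → Beats veto f c b) ↔ ∃ K < n + 1, ∀ b : Fin m,
      (Above veto c b → K < votes f b) ∧ (¬ Above veto c b → votes f b ≤ K) := by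
  cases veto
  · simp only [Beats, Above, Bool.false_eq_true, if_false, Fin.val_inj]
    constructor
    · intro h
      -- If `c` is the only alternative, it has a vote because there is a voter.
      have hc : 0 < votes f c := by
        by_cases h0 : f ⟨0, hn⟩ = c
        · refine sum_pos_iff.2 ⟨⟨0, hn⟩, mem_univ _, ?_⟩
          simp [h0]
        · exact Nat.zero_lt_of_lt (h _ h0)
      have := votes_le f c
      refine ⟨votes f c - 1, by omega, fun b => ⟨?_, fun hb => ?_⟩⟩
      · rintro rfl; omega
      · have := h b hb; omega
    · rintro ⟨K, -, hK⟩ b hb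
      exact ((hK b).2 hb).trans_lt ((hK c).1 rfl)
  · simp only [Beats, Above, if_true, ne_eq, Fin.val_inj, not_not]
    constructor
    · intro h
      have := votes_le f c
      exact ⟨votes f c, by omega, fun b => ⟨h b, fun hb => by rw [hb]⟩⟩
    · rintro ⟨K, -, hK⟩ b hb
      exact ((hK c).2 rfl).trans_lt ((hK b).1 hb)

theorem solvable_iff_briberyPossible (veto : Bool) {d : Distance} {κ : ℕ} (hd : TopDistance d κ)
    (I : BriberyInstance) :
    Solvable veto I.m I.n I.c I.budget (fun i b => placeCost veto κ I.m (I.budget + 1)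
      (extend I.δ i) (extend I.price i)
      (extend (fun i => extend (fun b => (I.profile i b : ℕ)) b) i)) ↔
    BriberyPossible (rule veto) d I := by
  rw [briberyPossible_iff veto hd, solvable_iff I.c.2]
  constructor
  · rintro ⟨f, hf, hsum, K, hK, hbar⟩
    refine ⟨fun i => ⟨f i, hf i i.2⟩, ?_,
      (beats_iff_exists_bar veto I.n_pos _ _).2 ⟨K, hK, fun b => ?_⟩⟩
    · rw [Finset.sum_range] at hsum
      refine le_trans (le_of_eq (sum_congr rfl fun i _ => ?_)) hsum
      simp only [extend_val]
      rw [extend_of_lt _ (hf i i.2)]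
    · have h : votes (fun i : Fin I.n => (⟨f i, hf i i.2⟩ : Fin I.m)) b =
          Nat.count (fun r => f r = b) I.n := by
        rw [votes_eq_count, Nat.count_eq_card_filter_range, Nat.count_eq_card_filter_range]
        congr 1
        refine filter_congr fun r hr => ?_
        rw [extend_of_lt _ (mem_range.1 hr)]
      rw [h]
      exact hbar b b.2
  · rintro ⟨f, hsum, hb⟩
    obtain ⟨K, hK, hbar⟩ := (beats_iff_exists_bar veto I.n_pos _ _).1 hb
    refine ⟨extend fun i => (f i : ℕ), fun r hr => ?_, ?_, K, hK, fun b hb => ?_⟩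
    · rw [extend_of_lt _ hr]; exact (f _).2
    · rw [Finset.sum_range]
      refine le_trans (le_of_eq (sum_congr rfl fun i _ => ?_)) hsum
      simp only [extend_val]
    · have := hbar ⟨b, hb⟩
      rwa [votes_eq_count] at this

theorem length_le_inputSize (w : List ℕ) : w.length ≤ inputSize w := by
  induction w with
  | nil => simp
  | cons a w ih =>
    simp only [inputSize, List.map_cons, List.sum_cons, List.length_cons] at ih ⊢
    omega

theorem size_le_inputSize {w : List ℕ} {v : ℕ} (h : v ∈ w) : v.size ≤ inputSize w := by
  induction w with
  | nil => simp at h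
  | cons a w ih =>
    simp only [inputSize, List.map_cons, List.sum_cons] at ih ⊢
    rcases List.mem_cons.1 h with rfl | h
    · omega
    · have := ih h
      omega

theorem initial_bounded (w : List ℕ) : (initial w).Bounded (inputSize w) := by
  intro a i
  unfold initial
  split_ifs
  · by_cases hi : i < w.length
    · rw [List.getD_eq_getElem _ _ hi]
      exact size_le_inputSize (List.getElem_mem hi)
    · rw [List.getD_eq_default _ _ (by omega)]
      simp
  · simp

theorem length_encode (I : BriberyInstance) : I.encode.length = 4 + I.n * (I.m + 2) := by
  have : ∀ i, (voterBlock I i).length = I.m + 2 := length_voterBlock I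
  rw [encode_eq, List.length_append, List.length_flatMap]
  simp [this]

theorem exists_polynomial_decideBound : ∃ D : Polynomial ℕ, ∀ M, D.eval M = decideBound M := by
  let X : Polynomial ℕ := Polynomial.X
  let F : Polynomial ℕ := X * (X * (4 * X + 4) * (X * 5 + 14) + 6) + (X * 6 + 9)
  let S : Polynomial ℕ := X * (F + 3) + (X * 8 + 15)
  refine ⟨X * (X * (X * 7 + 6) + S + 10) + X * (X * 6 + 6) + X * 9 + 29, fun M => ?_⟩
  simp [X, F, S, decideBound, Auction.solveBound, Auction.phaseBound]

theorem briberyPolyTime (veto : Bool) {d : Distance} {κ : ℕ} (hd : TopDistance d κ) :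
    BriberyPolyTime (rule veto) d := by
  obtain ⟨D, hD⟩ := exists_polynomial_decideBound
  set w := (decideBribery veto κ).weight
  let M : Polynomial ℕ := (Polynomial.X + 2) ^ 2
  let k : Polynomial ℕ := D.comp M
  refine ⟨decideBribery veto κ,
    k * (Polynomial.C w * (Polynomial.X + Polynomial.C w * k + 2)), fun I => ?_⟩
  set l := inputSize I.encode with hl
  have hlen : 4 + I.n * (I.m + 2) ≤ l := by
    rw [← length_encode]; exact length_le_inputSize _
  have hn := I.n_pos
  have hm : I.m ≤ l := by nlinarith
  have hnl : I.n ≤ l := by nlinarith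
  have hN : I.m * (I.n + 1) ≤ l * (l + 1) := Nat.mul_le_mul hm (by omega)
  have hB : I.budget.size ≤ l := size_le_inputSize (by simp [encode_eq])
  have hM : (l + 2) ^ 2 = l * (l + 1) + 3 * l + 4 := by ring
  have hsize : Nat.size ((I.m * (I.n + 1) + 1) * (I.budget + 1)) ≤ (l + 2) ^ 2 := by
    refine (size_mul_le _ _).trans ?_
    have h1 : (I.m * (I.n + 1) + 1).size ≤ l * (l + 1) + 1 :=
      Nat.size_le.2 ((Nat.lt_two_pow_self).trans_le (Nat.pow_le_pow_right (by omega) (by omega)))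
    have h2 : (I.budget + 1).size ≤ l + 1 :=
      size_add_le hB (Nat.size_le.2 (Nat.one_lt_two_pow (by omega)))
    omega
  obtain ⟨k', s', hsteps, hk', hs'⟩ := decideBribery_runs (veto := veto) (κ := κ)
    (M := (l + 2) ^ 2) (hasInput_encode I) rfl (by omega) (by omega) (by omega) hsize
  obtain ⟨⟨t, hexec, ht⟩, -⟩ := hsteps.exec w le_rfl decideBribery_tame l (initial_bounded _)
  refine ⟨t, s', hexec, ht.trans ?_, ?_⟩
  · simp only [k, M, Polynomial.eval_mul, Polynomial.eval_add, Polynomial.eval_C, Polynomial.eval_X,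
      Polynomial.eval_comp, Polynomial.eval_pow, Polynomial.eval_ofNat, hD]
    gcongr
  · rw [hs', solvable_iff_briberyPossible veto hd]

end Election

theorem mainTheorem1 :
    (Election.BriberyPolyTime Election.plurality Election.swapDistance ∧
      Election.BriberyPolyTime Election.plurality Election.footruleDistance ∧
      Election.BriberyPolyTime Election.plurality Election.maxDisplacementDistance) ∧
    (Election.BriberyPolyTime Election.veto Election.swapDistance ∧
      Election.BriberyPolyTime Election.veto Election.footruleDistance ∧
      Election.BriberyPolyTime Election.veto Election.maxDisplacementDistance) :=
  ⟨⟨Election.briberyPolyTime false Election.topDistance_swap,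
    Election.briberyPolyTime false Election.topDistance_footrule,
    Election.briberyPolyTime false Election.topDistance_maxDisplacement⟩,
   ⟨Election.briberyPolyTime true Election.topDistance_swap,
    Election.briberyPolyTime true Election.topDistance_footrule,
    Election.briberyPolyTime true Election.topDistance_maxDisplacement⟩⟩
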